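/- An orientation of a finite simple graph $G$ is an oriented graph obtained by choosing exactly one of the two directions for each edge of $G$. For $k\ge 3$ let $C_k^{\circlearrowright}$ be the directed cycle of length $k$; an orientation is $C_k^{\circlearrowright}$-free if it contains no (not necessarily induced) copy of $C_k^{\circlearrowright}$. Let $G(n,p)$ be the binomial random graph on $n$ labelled vertices, in which each pair of vertices is an edge independently with probability $p$, and let $\log$ be the natural logarithm. Theorem. For all integers $\ell, n\ge 1$ and every real $0<p\le (2^7\ell)^{-\ell}$, with high probability as $n\to\infty$, the random graph $G(n,p)$ admits at most \[\exp\left(\frac{13\,\ell\, n(\log n)^2}{p^{1/\ell}}\right)\] $C^{\circlearrowright}_{\ell+2}$-free orientations. Here "with high probability" is uniform in $\ell$ and $p$: for every $\varepsilon>0$ there is $N$ such that for all $n\ge N$, all integers $\ell\ge 1$ and all $0<p\le(2^7\ell)^{-\ell}$, the bound holds with probability at least $1-\varepsilon$. (In particular $\ell$ and $p$ may depend on $n$.) -/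

import Mathlib

/-- `D` is an orientation of the graph `G`: it has the same underlying edges as `G`, and each edge
of `G` receives exactly one of its two directions. -/
def IsOrientation {V : Type*} (G : SimpleGraph V) (D : Digraph V) : Prop :=
  (∀ u v, D.Adj u v → G.Adj u v) ∧ ∀ u v, G.Adj u v → Xor (D.Adj u v) (D.Adj v u)

/-- The directed cycle `0 → 1 → ⋯ → k - 1 → 0` of length `k` (addition in `Fin k` is modulo `k`). -/
def directedCycle (k : ℕ) [NeZero k] : Digraph (Fin k) where
  Adj i j := j = i + 1

/-- `D` contains no (not necessarily induced) copy of the digraph `F`. -/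
def DigraphFree {V W : Type*} (F : Digraph W) (D : Digraph V) : Prop :=
  ¬ ∃ f : W ↪ V, ∀ i j, F.Adj i j → D.Adj (f i) (f j)

/-- The number of orientations of `G` that contain no copy of `F`. -/
noncomputable def numFreeOrientations {V W : Type*} (G : SimpleGraph V) (F : Digraph W) : ℕ :=
  {D : Digraph V | IsOrientation G D ∧ DigraphFree F D}.ncard

/-! Put r = p / (1 - p). A graph G has probability r ^ e(G) / (1 + r) ^ (n choose 2), and each
orientation of G has e(G) arcs. Hence the expected number of cycle-free orientations, restricted to
graphs with typical edge distribution, is at most Z / (1 + r) ^ (n choose 2), where Z sums r ^ #D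
over all admissible arc sets D. Markov's inequality finishes the proof once Z is bounded.

Z is bounded by adding vertices one at a time (`sum_admissibleArcSets_insert_le`). A new vertex v,
attached to D on S with out-neighbourhood A and in-neighbourhood B, creates a directed (ℓ+2)-cycle
if D has a path with ℓ arcs from A to B. The weight of the allowed pairs (A, B) is an `avoidingSum`;
dividing it by (1 + r) ^ #S, the weight of adding v as an unoriented vertex, gives `avoidingMass`,
the price of orienting the edges at v.

Write a = p ^ (-1/ℓ) and lam = log n. By expansion, every S with at least ℓ a lam² / (2p) vertices
contains an x that reaches a fraction β = 1 / (12 ℓ a) of S by paths with ℓ arcs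
(`exists_forall_dipathIn`). Putting x into A therefore bars B from many vertices, and a recursion on
S bounds the mass by about exp(p s) n ^ (log n / β), with s the size threshold
(`avoidingMass_le_exp_mul_rpow`). Both exponents are of order ℓ a lam², and the n vertices together
give the bound. -/

open Finset Classical in
/-- The weighted number of pairs `(A, B)` of disjoint sets `A ⊆ S`, `B ⊆ T` such that no element
of `A` is related to an element of `B`; each pair has weight `r ^ (#A + #B)`. -/
noncomputable def avoidingSum {V : Type*} (R : V → V → Prop) (r : ℝ) (S T : Finset V) : ℝ :=
  ∑ A ∈ S.powerset, ∑ B ∈ T.powerset,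
    if Disjoint A B ∧ ∀ a ∈ A, ∀ b ∈ B, ¬ R a b then r ^ #A * r ^ #B else 0

/-! ### Weighted pairs of sets avoiding a relation. -/

section AvoidingSum

open Finset Classical

variable {V : Type*} {R : V → V → Prop} {r : ℝ}

lemma avoidingSum_nonneg (hr : 0 ≤ r) (S T : Finset V) : 0 ≤ avoidingSum R r S T := by
  refine sum_nonneg fun A _ => sum_nonneg fun B _ => ?_
  split_ifs <;> positivity

lemma avoidingSum_swap (S T : Finset V) :
    avoidingSum R r S T = avoidingSum (fun x y => R y x) r T S := by
  unfold avoidingSum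
  rw [sum_comm]
  refine sum_congr rfl fun B _ => sum_congr rfl fun A _ => ?_
  have : (Disjoint A B ∧ ∀ a ∈ A, ∀ b ∈ B, ¬ R a b) ↔
      (Disjoint B A ∧ ∀ a ∈ B, ∀ b ∈ A, ¬ R b a) := by
    rw [disjoint_comm]
    exact and_congr_right fun _ => ⟨fun h a ha b hb => h b hb a ha, fun h a ha b hb => h b hb a ha⟩
  simp only [this, mul_comm]

lemma avoidingSum_insert_left_le_add (hr : 0 ≤ r) {x : V} {S : Finset V} (hx : x ∉ S)
    (T Y : Finset V) (hY : ∀ y ∈ Y, R x y) :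
    avoidingSum R r (insert x S) T ≤
      avoidingSum R r S T + r * avoidingSum R r S ((T.erase x) \ Y) := by
  unfold avoidingSum
  rw [sum_powerset_insert hx]
  gcongr
  rw [mul_sum]
  refine sum_le_sum fun A hA => ?_
  have hxA : x ∉ A := fun h => hx (mem_powerset.1 hA h)
  rw [mul_sum]
  have hsub : ((T.erase x) \ Y).powerset ⊆ T.powerset :=
    powerset_mono.2 (sdiff_subset.trans (erase_subset _ _))
  rw [← sum_subset hsub]
  · refine sum_le_sum fun B _ => ?_
    rw [card_insert_of_notMem hxA]
    by_cases h : Disjoint (insert x A) B ∧ ∀ a ∈ insert x A, ∀ b ∈ B, ¬ R a b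
    · have h' : Disjoint A B ∧ ∀ a ∈ A, ∀ b ∈ B, ¬ R a b :=
        ⟨h.1.mono_left (subset_insert _ _), fun a ha => h.2 a (mem_insert_of_mem ha)⟩
      rw [if_pos h, if_pos h', pow_succ]
      exact le_of_eq (by ring)
    · rw [if_neg h]
      refine mul_nonneg hr ?_
      split_ifs <;> positivity
  · intro B hB hB'
    refine if_neg fun h => hB' ?_
    rw [mem_powerset] at hB ⊢
    intro b hb
    rw [mem_sdiff, mem_erase]
    refine ⟨⟨?_, hB hb⟩, fun hbY => h.2 x (mem_insert_self _ _) b hb (hY b hbY)⟩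
    rintro rfl
    exact disjoint_left.1 h.1 (mem_insert_self _ _) hb

lemma avoidingSum_mono_right (hr : 0 ≤ r) (S : Finset V) {T T' : Finset V} (h : T ⊆ T') :
    avoidingSum R r S T ≤ avoidingSum R r S T' := by
  refine sum_le_sum fun A _ => sum_le_sum_of_subset_of_nonneg (powerset_mono.2 h) fun B _ _ => ?_
  split_ifs <;> positivity

lemma avoidingSum_insert_left_le (hr : 0 ≤ r) {x : V} {S : Finset V} (hx : x ∉ S)
    (T : Finset V) :
    avoidingSum R r (insert x S) T ≤ (1 + r) * avoidingSum R r S T := by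
  have h1 := avoidingSum_insert_left_le_add (R := R) hr hx T ∅ (by simp)
  have h2 : avoidingSum R r S ((T.erase x) \ ∅) ≤ avoidingSum R r S T :=
    avoidingSum_mono_right hr S (sdiff_subset.trans (erase_subset _ _))
  nlinarith [mul_le_mul_of_nonneg_left h2 hr]

lemma avoidingSum_insert_right_le (hr : 0 ≤ r) {x : V} (S : Finset V) {T : Finset V}
    (hx : x ∉ T) :
    avoidingSum R r S (insert x T) ≤ (1 + r) * avoidingSum R r S T := by
  rw [avoidingSum_swap, avoidingSum_swap S T]
  exact avoidingSum_insert_left_le hr hx S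

lemma avoidingSum_union_left_le (hr : 0 ≤ r) (S T Y : Finset V) (h : Disjoint Y S) :
    avoidingSum R r (Y ∪ S) T ≤ (1 + r) ^ #Y * avoidingSum R r S T := by
  induction Y using Finset.induction_on with
  | empty => simp
  | insert y Y hy ih =>
    rw [disjoint_insert_left] at h
    rw [insert_union, card_insert_of_notMem hy, pow_succ']
    calc _ ≤ (1 + r) * avoidingSum R r (Y ∪ S) T :=
          avoidingSum_insert_left_le hr (by simp [hy, h.1]) T
      _ ≤ (1 + r) * ((1 + r) ^ #Y * avoidingSum R r S T) := by
          gcongr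
          exact ih h.2
      _ = _ := by ring

/-- The normalised version of `avoidingSum R r S S`. -/
noncomputable def avoidingMass (R : V → V → Prop) (r : ℝ) (S : Finset V) : ℝ :=
  avoidingSum R r S S / (1 + r) ^ #S

/-- If x is not in A, allowing it in B costs 1 + r, which the normalisation absorbs. If x is in A,
then B misses Y, so each vertex of Y contributes at most 1 + r through A alone, again absorbed; what
remains is r / (1 + r), which is p in the application. -/
lemma avoidingMass_insert_le (hr : 0 ≤ r) {x : V} {S Y : Finset V} (hx : x ∉ S) (hYS : Y ⊆ S)
    (hY : ∀ y ∈ Y, R x y) :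
    avoidingMass R r (insert x S) ≤
      avoidingMass R r S + r / (1 + r) * avoidingMass R r (S \ Y) := by
  have h1 := avoidingSum_insert_left_le_add (R := R) hr hx (insert x S) Y hY
  rw [erase_insert hx] at h1
  have h2 := avoidingSum_insert_right_le (R := R) hr S hx
  have h3 := avoidingSum_union_left_le (R := R) hr (S \ Y) (S \ Y) Y disjoint_sdiff
  rw [union_sdiff_of_subset hYS] at h3
  have hc : #S = #Y + #(S \ Y) := by rw [card_sdiff_of_subset hYS]; have := card_le_card hYS; omega
  have h4 : avoidingSum R r (insert x S) (insert x S) ≤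
      (1 + r) * avoidingSum R r S S + r * ((1 + r) ^ #Y * avoidingSum R r (S \ Y) (S \ Y)) :=
    h1.trans (add_le_add h2 (mul_le_mul_of_nonneg_left h3 hr))
  have hpos : 0 < 1 + r := by positivity
  unfold avoidingMass
  rw [card_insert_of_notMem hx, div_le_iff₀ (by positivity)]
  refine h4.trans (le_of_eq ?_)
  rw [hc, pow_succ, pow_add]
  field_simp

lemma avoidingMass_le_pow (hr : 0 ≤ r) (S : Finset V) :
    avoidingMass R r S ≤ (1 + r / (1 + r)) ^ #S := by
  induction S using Finset.induction_on with
  | empty => simp [avoidingMass, avoidingSum]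
  | insert x S hx ih =>
    have h := avoidingMass_insert_le (R := R) (Y := ∅) hr hx (empty_subset _) (by simp)
    rw [sdiff_empty] at h
    rw [card_insert_of_notMem hx, pow_succ]
    have : 0 ≤ r / (1 + r) := by positivity
    nlinarith

/-- The recursion mass(S) ≤ mass(S - x) + p mass(S - x - Y) branches into a set smaller by a factor
1 - β, which can happen about log(#S / s) / β times before the size drops below s. There the trivial
bound (1 + p) ^ #S ≤ exp(p s) takes over. -/
lemma avoidingMass_le_exp_mul_rpow (hr : 0 ≤ r) {p s β : ℝ} (hp : p = r / (1 + r)) (hs : 0 < s)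
    (hβ : 0 < β) (W : Finset V)
    (h : ∀ S ⊆ W, s ≤ #S → ∃ x ∈ S, ∃ Y ⊆ S, x ∉ Y ∧ (∀ y ∈ Y, R x y) ∧ β * #S ≤ #Y)
    (S : Finset V) (hS : S ⊆ W) :
    avoidingMass R r S ≤ Real.exp (p * s) *
      (1 + p * (#S : ℝ)) ^ (if (#S : ℝ) < s then 0 else 1 + Real.log ((#S : ℝ) / s) / β) := by
  have hp0 : 0 ≤ p := by rw [hp]; positivity
  induction S using Finset.strongInduction with
  | H S ih =>
    by_cases hlt : (#S : ℝ) < s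
    · rw [if_pos hlt, Real.rpow_zero, mul_one]
      calc _ ≤ (1 + p) ^ #S := hp ▸ avoidingMass_le_pow hr S
        _ ≤ Real.exp p ^ #S := by
          gcongr
          linarith [Real.add_one_le_exp p]
        _ = Real.exp (p * #S) := by rw [← Real.exp_nat_mul, mul_comm]
        _ ≤ _ := Real.exp_le_exp.2 (mul_le_mul_of_nonneg_left hlt.le hp0)
    · rw [if_neg hlt]
      push Not at hlt
      obtain ⟨x, hxS, Y, hYS, hxY, hRY, hcard⟩ := h S hS hlt
      set k : ℝ := (#S : ℝ) with hk
      set τ : ℝ := 1 + Real.log (k / s) / β with hτ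
      have hkpos : 0 < k := hs.trans_le hlt
      have hτ1 : 1 ≤ τ := by
        have : 0 ≤ Real.log (k / s) := Real.log_nonneg ((one_le_div hs).2 hlt)
        have : 0 ≤ Real.log (k / s) / β := by positivity
        linarith
      have hY' : Y ⊆ S.erase x := fun y hy =>
        mem_erase.2 ⟨fun e => hxY (e ▸ hy), hYS hy⟩
      have hrec := avoidingMass_insert_le hr (notMem_erase x S) hY' hRY
      rw [insert_erase hxS, ← hp] at hrec
      have hc1 : ((#(S.erase x) : ℕ) : ℝ) = k - 1 := by
        rw [card_erase_of_mem hxS, Nat.cast_sub (card_pos.2 ⟨x, hxS⟩)]; simp [hk]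
      have hk1 : 0 ≤ k - 1 := by rw [← hc1]; positivity
      have hc2 : ((#(S.erase x \ Y) : ℕ) : ℝ) ≤ (1 - β) * k := by
        rw [card_sdiff_of_subset hY', Nat.cast_sub (card_le_card hY'), hc1]
        linarith
      have e1 := ih (S.erase x) (erase_ssubset hxS) ((erase_subset _ _).trans hS)
      have e2 := ih (S.erase x \ Y) (sdiff_subset.trans_ssubset (erase_ssubset hxS))
        (sdiff_subset.trans ((erase_subset _ _).trans hS))
      have f1 : (1 + p * (#(S.erase x) : ℝ)) ^ (if (#(S.erase x) : ℝ) < s then 0 else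
          1 + Real.log (#(S.erase x) / s) / β) ≤ (1 + p * (k - 1)) ^ τ := by
        rw [hc1]
        refine Real.rpow_le_rpow_of_exponent_le (by nlinarith) ?_
        split_ifs with hh
        · linarith
        · push Not at hh
          have h0 : 0 < (k - 1) / s := div_pos (hs.trans_le hh) hs
          have h1 : Real.log ((k - 1) / s) ≤ Real.log (k / s) :=
            Real.log_le_log h0 (div_le_div_of_nonneg_right (by linarith) hs.le)
          rw [hτ]
          gcongr
      -- Since log(1 - β) ≤ -β, removing Y lowers the exponent by at least 1. Below s the exponent
      -- is 0, and τ - 1 ≥ 0 suffices.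
      have f2 : (1 + p * (#(S.erase x \ Y) : ℝ)) ^ (if (#(S.erase x \ Y) : ℝ) < s then 0 else
          1 + Real.log (#(S.erase x \ Y) / s) / β) ≤ (1 + p * k) ^ (τ - 1) := by
        set m : ℝ := (#(S.erase x \ Y) : ℝ) with hm
        have hm0 : 0 ≤ m := by positivity
        have hmk : m ≤ k := by nlinarith
        calc _ ≤ (1 + p * m) ^ (τ - 1) := by
              refine Real.rpow_le_rpow_of_exponent_le (by nlinarith [mul_nonneg hp0 hm0]) ?_
              split_ifs with hh
              · linarith
              · push Not at hh
                have hmpos : 0 < m := hs.trans_le hh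
                have hb : 0 < 1 - β := by
                  by_contra hcon
                  push Not at hcon
                  nlinarith
                have : Real.log (m / s) ≤ Real.log (k / s) - β := by
                  calc Real.log (m / s) ≤ Real.log ((1 - β) * (k / s)) := by
                        apply Real.log_le_log (by positivity)
                        rw [← mul_div_assoc]
                        gcongr
                    _ = Real.log (1 - β) + Real.log (k / s) :=
                        Real.log_mul hb.ne' (by positivity)
                    _ ≤ _ := by linarith [Real.log_le_sub_one_of_pos hb]
                have h3 : Real.log (m / s) / β ≤ (Real.log (k / s) - β) / β := by gcongr
                rw [sub_div, div_self hβ.ne'] at h3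
                linarith
          _ ≤ _ := by
              refine Real.rpow_le_rpow (by positivity) ?_ (by linarith)
              gcongr
      have hE : 0 < Real.exp (p * s) := Real.exp_pos _
      have ha : 0 < 1 + p * k := by positivity
      have ha' : 0 < 1 + p * (k - 1) := by positivity
      have key : (1 + p * (k - 1)) ^ τ + p * (1 + p * k) ^ (τ - 1) ≤ (1 + p * k) ^ τ := by
        have g1 : (1 + p * (k - 1)) ^ τ = (1 + p * (k - 1)) ^ (τ - 1) * (1 + p * (k - 1)) := by
          rw [← Real.rpow_add_one ha'.ne', sub_add_cancel]
        have g2 : (1 + p * k) ^ τ = (1 + p * k) ^ (τ - 1) * (1 + p * k) := by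
          rw [← Real.rpow_add_one ha.ne', sub_add_cancel]
        have g3 : (1 + p * (k - 1)) ^ (τ - 1) ≤ (1 + p * k) ^ (τ - 1) :=
          Real.rpow_le_rpow ha'.le (by nlinarith) (by linarith)
        rw [g1, g2]
        have g4 := mul_le_mul_of_nonneg_right g3 ha'.le
        linarith
      calc avoidingMass R r S ≤ _ := hrec
        _ ≤ Real.exp (p * s) * (1 + p * (k - 1)) ^ τ +
            p * (Real.exp (p * s) * (1 + p * k) ^ (τ - 1)) := by
          gcongr
          · exact e1.trans (mul_le_mul_of_nonneg_left f1 hE.le)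
          · exact e2.trans (mul_le_mul_of_nonneg_left f2 hE.le)
        _ = Real.exp (p * s) * ((1 + p * (k - 1)) ^ τ + p * (1 + p * k) ^ (τ - 1)) := by ring
        _ ≤ _ := mul_le_mul_of_nonneg_left key hE.le

end AvoidingSum

/-! ### Expansion along directed paths in pseudorandom digraphs. -/

section Dipaths

open Finset

variable {V : Type*}

/-- There is a directed path `x = f 0 → f 1 → ⋯ → f k = y` with arcs in `D` and `k + 1` distinct
vertices, all of them in `P`. -/
def DipathIn (D : Finset (V × V)) (P : Finset V) (k : ℕ) (x y : V) : Prop :=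
  ∃ f : ℕ → V, f 0 = x ∧ f k = y ∧ Set.InjOn f (Set.Iic k) ∧ (∀ i ≤ k, f i ∈ P) ∧
    ∀ i < k, (f i, f (i + 1)) ∈ D

lemma DipathIn.mono {D : Finset (V × V)} {P P' : Finset V} {k : ℕ} {x y : V}
    (h : DipathIn D P k x y) (hP : P ⊆ P') : DipathIn D P' k x y := by
  obtain ⟨f, h0, hk, hinj, hmem, harc⟩ := h
  exact ⟨f, h0, hk, hinj, fun i hi => hP (hmem i hi), harc⟩

lemma DipathIn.refl {D : Finset (V × V)} (x : V) : DipathIn D {x} 0 x x := by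
  refine ⟨fun _ => x, rfl, rfl, ?_, by simp, by simp⟩
  intro i hi j hj _
  simp only [Set.mem_Iic, Nat.le_zero] at hi hj
  rw [hi, hj]

variable [DecidableEq V]

/-- The out-neighbours of `v` in `R`. -/
def outNbrs (D : Finset (V × V)) (R : Finset V) (v : V) : Finset V := {w ∈ R | (v, w) ∈ D}

/-- The number of arcs of `D` from `Q` to `N`. -/
def arcCount (D : Finset (V × V)) (Q N : Finset V) : ℕ := #{e ∈ D | e.1 ∈ Q ∧ e.2 ∈ N}

/-- No two subsets of `S` span many more arcs than expected at density `p`. -/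
def HasFewArcs (D : Finset (V × V)) (S : Finset V) (p lam : ℝ) : Prop :=
  ∀ Q ⊆ S, ∀ N ⊆ S, (arcCount D Q N : ℝ) ≤ 2 * p * #Q * #N + 3 * (#Q + #N) * lam

/-- Every large subset of `S` spans at least half as many arcs as expected at density `p`. -/
def HasManyArcs (D : Finset (V × V)) (S : Finset V) (p lam : ℝ) : Prop :=
  ∀ L ⊆ S, lam ^ 2 / (4 * p) ≤ #L → p * (#L : ℝ) ^ 2 / 4 ≤ arcCount D L L

variable {D : Finset (V × V)}

lemma DipathIn.snoc {P : Finset V} {k : ℕ} {x a w : V} (h : DipathIn D P k x a)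
    (haw : (a, w) ∈ D) (hw : w ∉ P) : DipathIn D (insert w P) (k + 1) x w := by
  obtain ⟨f, h0, hk, hinj, hmem, harc⟩ := h
  have hf : ∀ i ≤ k, Function.update f (k + 1) w i = f i := fun i hi =>
    Function.update_of_ne (by omega) _ _
  refine ⟨Function.update f (k + 1) w, by rw [hf 0 (Nat.zero_le _), h0], by simp, ?_, ?_, ?_⟩
  · intro i hi j hj hij
    simp only [Set.mem_Iic] at hi hj
    rcases Nat.lt_or_ge k i with hi' | hi' <;> rcases Nat.lt_or_ge k j with hj' | hj'
    · omega
    · obtain rfl : i = k + 1 := by omega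
      rw [hf j hj', Function.update_self] at hij
      exact absurd (hij ▸ hmem j hj') hw
    · obtain rfl : j = k + 1 := by omega
      rw [hf i hi', Function.update_self] at hij
      exact absurd (hij ▸ hmem i hi') hw
    · rw [hf i hi', hf j hj'] at hij
      exact hinj hi' hj' hij
  · intro i hi
    rcases Nat.lt_or_ge k i with hi' | hi'
    · obtain rfl : i = k + 1 := by omega
      simp
    · rw [hf i hi']
      exact mem_insert_of_mem (hmem i hi')
  · intro i hi
    rcases Nat.lt_or_ge i k with hi' | hi'
    · rw [hf i hi'.le, hf (i + 1) hi']
      exact harc i hi'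
    · obtain rfl : i = k := by omega
      rw [hf i le_rfl, Function.update_self, hk]
      exact haw

lemma arcCount_eq_sum (D : Finset (V × V)) (Q N : Finset V) :
    arcCount D Q N = ∑ v ∈ Q, #(outNbrs D N v) := by
  unfold arcCount outNbrs
  rw [← card_sigma]
  refine card_bij' (fun e _ => ⟨e.1, e.2⟩) (fun e _ => (e.1, e.2)) ?_ ?_ ?_ ?_
  · rintro ⟨u, v⟩ h
    simp only [mem_filter] at h
    simp [h]
  · rintro ⟨u, v⟩ h
    simp only [mem_sigma, mem_filter] at h
    simp [h]
  · intros; rfl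
  · intros; rfl

lemma outNbrs_mono {R R' : Finset V} (h : R ⊆ R') (v : V) : outNbrs D R v ⊆ outNbrs D R' v :=
  filter_subset_filter _ h

open Classical in
/-- Iteratively discard the vertices of out-degree less than `η`. -/
noncomputable def outCore (D : Finset (V × V)) (η : ℝ) (S : Finset V) : ℕ → Finset V
  | 0 => S
  | i + 1 => {v ∈ outCore D η S i | η ≤ #(outNbrs D (outCore D η S i) v)}

lemma outCore_succ_subset (η : ℝ) (S : Finset V) (i : ℕ) :
    outCore D η S (i + 1) ⊆ outCore D η S i := by
  classical
  exact filter_subset _ _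

lemma outCore_subset (η : ℝ) (S : Finset V) (i : ℕ) : outCore D η S i ⊆ S := by
  induction i with
  | zero => exact Subset.rfl
  | succ i ih => exact (outCore_succ_subset η S i).trans ih

lemma le_card_outNbrs_of_mem_outCore {η : ℝ} {S : Finset V} {i : ℕ} {v : V}
    (h : v ∈ outCore D η S (i + 1)) : η ≤ #(outNbrs D (outCore D η S i) v) := by
  classical
  rw [outCore, mem_filter] at h
  exact h.2

/-- The vertices discarded in one round send fewer than η arcs each into one another. If there were
b of them, `HasManyArcs` would force an average of at least p b / 4 ≥ η. -/
lemma card_outCore_sdiff_lt {S : Finset V} {p lam η b : ℝ} (hp : 0 < p)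
    (hmany : HasManyArcs D S p lam) (hb : lam ^ 2 / (4 * p) ≤ b) (hb0 : 0 < b)
    (hη : η ≤ p * b / 4) (i : ℕ) :
    (#(outCore D η S i \ outCore D η S (i + 1)) : ℝ) < b := by
  classical
  set L := outCore D η S i \ outCore D η S (i + 1) with hL
  by_contra hcon
  push Not at hcon
  have hLS : L ⊆ S := sdiff_subset.trans (outCore_subset η S i)
  have h1 := hmany L hLS (hb.trans hcon)
  have hne : L.Nonempty := by
    rw [← card_pos]
    exact_mod_cast hb0.trans_le hcon
  have h2 : (arcCount D L L : ℝ) < ∑ _v ∈ L, η := by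
    rw [arcCount_eq_sum]
    push_cast
    refine sum_lt_sum_of_nonempty hne fun v hv => ?_
    rw [hL, mem_sdiff, outCore, mem_filter, not_and, not_le] at hv
    refine lt_of_le_of_lt ?_ (hv.2 hv.1)
    exact_mod_cast card_le_card (outNbrs_mono sdiff_subset v)
  rw [sum_const, nsmul_eq_mul] at h2
  have hpos : (0 : ℝ) < #L := hb0.trans_le hcon
  have h3 : (#L : ℝ) * η ≤ #L * (p * #L / 4) := by
    gcongr
    exact hη.trans (by gcongr)
  nlinarith

lemma card_sub_le_card_outCore {S : Finset V} {p lam η b : ℝ} (hp : 0 < p)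
    (hmany : HasManyArcs D S p lam) (hb : lam ^ 2 / (4 * p) ≤ b) (hb0 : 0 < b)
    (hη : η ≤ p * b / 4) (i : ℕ) :
    (#S : ℝ) - i * b ≤ #(outCore D η S i) := by
  induction i with
  | zero => simp [outCore]
  | succ i ih =>
    have h1 := card_outCore_sdiff_lt hp hmany hb hb0 hη i
    have h2 := card_sdiff_add_card_eq_card (outCore_succ_subset (D := D) η S i)
    have h3 : (#(outCore D η S i \ outCore D η S (i + 1)) : ℝ) + #(outCore D η S (i + 1)) =
      #(outCore D η S i) := by exact_mod_cast h2
    push_cast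
    linarith

/-- The vertices of `R` outside `P` that receive an arc from `Q`. -/
def newNbrs (D : Finset (V × V)) (Q P R : Finset V) : Finset V :=
  {w ∈ R | w ∉ P ∧ ∃ a ∈ Q, (a, w) ∈ D}

/-- All arcs from Q into R end in the new neighbours or in the used set P, so large out-degrees
force this union to be large. -/
lemma mul_card_le_of_hasFewArcs {S Q P R : Finset V} {p lam η : ℝ}
    (hfew : HasFewArcs D S p lam) (hQ : Q ⊆ S) (hP : P ⊆ S) (hR : R ⊆ S)
    (hη : ∀ a ∈ Q, η ≤ #(outNbrs D R a)) :
    η * #Q ≤ 2 * p * #Q * #(newNbrs D Q P R ∪ P) +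
      3 * (#Q + #(newNbrs D Q P R ∪ P)) * lam := by
  have hN : newNbrs D Q P R ∪ P ⊆ S := union_subset ((filter_subset _ _).trans hR) hP
  refine le_trans ?_ (hfew Q hQ _ hN)
  rw [arcCount_eq_sum]
  push_cast
  calc η * #Q = ∑ _a ∈ Q, η := by rw [sum_const, nsmul_eq_mul, mul_comm]
    _ ≤ _ := by
      refine sum_le_sum fun a ha => (hη a ha).trans ?_
      norm_cast
      refine card_le_card fun w hw => ?_
      simp only [outNbrs, newNbrs, mem_filter, mem_union] at hw ⊢
      refine ⟨?_, hw.2⟩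
      by_cases hwP : w ∈ P
      · exact Or.inr hwP
      · exact Or.inl ⟨hw.1, hwP, a, ha, hw.2⟩

lemma dipathIn_of_mem_newNbrs {Q P R : Finset V} {k : ℕ} {x w : V}
    (hQ : ∀ y ∈ Q, DipathIn D P k x y) (hw : w ∈ newNbrs D Q P R) :
    DipathIn D (insert w P) (k + 1) x w := by
  simp only [newNbrs, mem_filter] at hw
  obtain ⟨-, hwP, a, ha, haw⟩ := hw
  exact (hQ a ha).snoc haw hwP

lemma outNbrs_subset_newNbrs_singleton (hirr : ∀ v, (v, v) ∉ D) (R : Finset V) (x : V) :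
    outNbrs D R x ⊆ newNbrs D {x} {x} R := by
  intro w hw
  simp only [outNbrs, newNbrs, mem_filter, mem_singleton, exists_eq_left] at hw ⊢
  refine ⟨hw.1, ?_, hw.2⟩
  rintro rfl
  exact hirr _ hw.2

/-- Breadth-first expansion from x: each step multiplies the level size by κ and uses up one round
of the core. P collects the levels, so that a path inside P extends by any new neighbour without
repeating a vertex; as κ ≥ 2, the sizes sum geometrically to at most twice the last. -/
lemma exists_level {S : Finset V} {p lam η : ℝ} {ℓ M κ : ℕ} (hp : 0 ≤ p) (hlam : 0 ≤ lam)
    (hirr : ∀ v, (v, v) ∉ D) (hfew : HasFewArcs D S p lam) (hκ : 2 ≤ κ) (hM : 1 ≤ M)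
    (hη₁ : (M * κ : ℝ) ≤ η)
    (hη₂ : ∀ i < ℓ, 4 * p * (M * (κ : ℝ) ^ i) + 9 * κ * lam < η)
    {x : V} (hx : x ∈ outCore D η S ℓ) (j : ℕ) (hj : j + 1 < ℓ) :
    ∃ Q P : Finset V, Q ⊆ outCore D η S (ℓ - (j + 1)) ∧ P ⊆ S ∧
      #Q = M * κ ^ (j + 1) ∧ #P ≤ 2 * (M * κ ^ (j + 1)) ∧
      ∀ y ∈ Q, DipathIn D P (j + 1) x y := by
  have build : ∀ (k i : ℕ) (Q P : Finset V), P ⊆ S → (∀ y ∈ Q, DipathIn D P k x y) →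
      ∀ m : ℕ, m ≤ #(newNbrs D Q P (outCore D η S i)) → ∃ Q' P' : Finset V,
        Q' ⊆ outCore D η S i ∧ P' ⊆ S ∧ #Q' = m ∧ #P' ≤ #P + m ∧
          ∀ y ∈ Q', DipathIn D P' (k + 1) x y := by
    intro k i Q P hPS hQ m hm
    obtain ⟨Q', hQ', hcard⟩ := exists_subset_card_eq hm
    refine ⟨Q', P ∪ Q', hQ'.trans (filter_subset _ _), union_subset hPS
      ((hQ'.trans (filter_subset _ _)).trans (outCore_subset _ _ _)), hcard,
      (card_union_le _ _).trans (by rw [hcard]), fun y hy => ?_⟩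
    refine (dipathIn_of_mem_newNbrs hQ (hQ' hy)).mono ?_
    exact insert_subset (mem_union_right _ hy) subset_union_left
  induction j with
  | zero =>
    obtain ⟨i, hi⟩ : ∃ i, ℓ = i + 1 := ⟨ℓ - 1, by omega⟩
    have hxS : x ∈ S := outCore_subset _ _ _ hx
    rw [hi] at hx
    have h1 := le_card_outNbrs_of_mem_outCore hx
    have h2 : M * κ ≤ #(newNbrs D {x} {x} (outCore D η S i)) := by
      have h3 : (M * κ : ℝ) ≤ #(outNbrs D (outCore D η S i) x) := hη₁.trans h1
      exact (by exact_mod_cast h3 : M * κ ≤ _).trans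
        (card_le_card (outNbrs_subset_newNbrs_singleton hirr _ _))
    obtain ⟨Q, P, hQ, hP, hQc, hPc, hpath⟩ := build 0 i {x} {x} (by simpa using hxS)
      (by simpa using DipathIn.refl x) _ h2
    refine ⟨Q, P, ?_, hP, by simpa using hQc, ?_, by simpa using hpath⟩
    · have : ℓ - (0 + 1) = i := by omega
      rwa [this]
    · simp only [card_singleton] at hPc
      have : 1 ≤ M * κ := Nat.mul_pos hM (by omega)
      simp only [zero_add, pow_one]
      omega
  | succ j ih =>
    obtain ⟨Q, P, hQ, hP, hQc, hPc, hpath⟩ := ih (by omega)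
    obtain ⟨i, hi⟩ : ∃ i, ℓ - (j + 1) = i + 1 := ⟨ℓ - (j + 2), by omega⟩
    rw [hi] at hQ
    have hi' : ℓ - (j + 1 + 1) = i := by omega
    have hpow : 0 < M * κ ^ (j + 1) := Nat.mul_pos hM (pow_pos (by omega) _)
    have h2 : M * κ ^ (j + 1 + 1) ≤ #(newNbrs D Q P (outCore D η S i)) := by
      by_contra hcon
      push Not at hcon
      have h3 := mul_card_le_of_hasFewArcs (η := η) hfew (hQ.trans (outCore_subset _ _ _)) hP
        (outCore_subset η S i) (fun a ha => le_card_outNbrs_of_mem_outCore (hQ ha))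
      set N := newNbrs D Q P (outCore D η S i) ∪ P with hN
      have h4 : #N ≤ 2 * (M * κ ^ (j + 1 + 1)) := by
        have h5 : #N ≤ _ := card_union_le _ _
        have h6 : 2 * (M * κ ^ (j + 1)) ≤ M * κ ^ (j + 1 + 1) := by
          rw [pow_succ κ (j + 1)]
          nlinarith
        omega
      set q : ℝ := ((M * κ ^ (j + 1) : ℕ) : ℝ) with hq
      have hq0 : 0 < q := by rw [hq]; exact_mod_cast hpow
      have hQq : (#Q : ℝ) = q := by rw [hQc]
      have hNq : (#N : ℝ) ≤ 2 * (κ * q) := by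
        have : (#N : ℝ) ≤ (2 * (M * κ ^ (j + 1 + 1)) : ℕ) := by exact_mod_cast h4
        rw [hq]
        push_cast at this ⊢
        rw [pow_succ] at this
        linarith
      have hκ1 : (1 : ℝ) ≤ κ := by exact_mod_cast (by omega : 1 ≤ κ)
      have h7 := hη₂ (j + 1 + 1) hj
      have h8 : (M * (κ : ℝ) ^ (j + 1 + 1)) = κ * q := by
        rw [hq]; push_cast; ring
      rw [h8] at h7
      rw [hQq] at h3
      have h9 : η * q ≤ (4 * p * (κ * q) + 9 * κ * lam) * q := by
        calc η * q ≤ _ := h3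
          _ ≤ 2 * p * q * (2 * (κ * q)) + 3 * (q + 2 * (κ * q)) * lam := by gcongr
          _ ≤ 2 * p * q * (2 * (κ * q)) + 3 * (κ * q + 2 * (κ * q)) * lam := by
            gcongr
            nlinarith
          _ = _ := by ring
      exact absurd (le_of_mul_le_mul_right h9 hq0) (not_le.2 h7)
    obtain ⟨Q', P', hQ', hP', hQc', hPc', hpath'⟩ := build (j + 1) i Q P hP hpath _ h2
    refine ⟨Q', P', by rwa [hi'], hP', hQc', ?_, hpath'⟩
    have h6 : 2 * (M * κ ^ (j + 1)) ≤ M * κ ^ (j + 1 + 1) := by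
      rw [pow_succ κ (j + 1)]
      nlinarith
    omega

/-- Levels grow by a factor of about a for ℓ - 1 steps, up to size about lam / (p a). At that size
the error term in `HasFewArcs` no longer obstructs the last step, which reaches a constant multiple
of #S / (ℓ a) vertices. -/
lemma exists_forall_dipathIn {S : Finset V} {p lam a : ℝ} {ℓ : ℕ} (hℓ : 1 ≤ ℓ) (hp : 0 < p)
    (hlam : 3000 ≤ lam) (ha : 128 * ℓ ≤ a) (hap : a ^ ℓ * p = 1) (hirr : ∀ v, (v, v) ∉ D)
    (hfew : HasFewArcs D S p lam) (hmany : HasManyArcs D S p lam)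
    (hS : ℓ * a * lam ^ 2 / (2 * p) ≤ #S) :
    ∃ x ∈ S, ∃ Y ⊆ S, x ∉ Y ∧ (∀ y ∈ Y, DipathIn D S ℓ x y) ∧ 1 / (12 * ℓ * a) * #S ≤ #Y := by
  have hℓ1 : (1 : ℝ) ≤ ℓ := by exact_mod_cast hℓ
  have ha128 : 128 ≤ a := by nlinarith
  have ha0 : 0 < a := by linarith
  set σ : ℝ := (#S : ℝ) with hσ
  have hσ0 : 0 < σ := lt_of_lt_of_le (by positivity) hS
  -- With b = σ / (2ℓ) below and η = p b / 4, the ℓ rounds of discarding remove at most half of S.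
  set η : ℝ := p * σ / (8 * ℓ) with hη
  have hη0 : 0 < η := by positivity
  have hηlow : a * lam ^ 2 / 16 ≤ η := by
    rw [hη, div_le_div_iff₀ (by norm_num) (by positivity)]
    rw [div_le_iff₀ (by positivity)] at hS
    nlinarith
  have hηlow' : 187 * a * lam ≤ η := by
    refine le_trans ?_ hηlow
    nlinarith [mul_nonneg ha0.le (by linarith : 0 ≤ lam)]
  set b : ℝ := σ / (2 * ℓ) with hb
  have hb0 : 0 < b := by positivity
  have hblow : lam ^ 2 / (4 * p) ≤ b := by
    rw [hb, div_le_div_iff₀ (by positivity) (by positivity)]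
    rw [div_le_iff₀ (by positivity)] at hS
    have : (ℓ : ℝ) * lam ^ 2 * 1 ≤ ℓ * lam ^ 2 * a := by gcongr; linarith
    nlinarith
  have hηb : η ≤ p * b / 4 := by
    apply le_of_eq
    rw [hη, hb]
    field_simp
    norm_num
  have hcore := card_sub_le_card_outCore hp hmany hblow hb0 hηb ℓ
  have hne : (outCore D η S ℓ).Nonempty := by
    rw [← card_pos]
    have : (ℓ : ℝ) * b = σ / 2 := by rw [hb]; field_simp
    have : (0 : ℝ) < #(outCore D η S ℓ) := by linarith
    exact_mod_cast this
  obtain ⟨x, hx⟩ := hne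
  have hxS : x ∈ S := outCore_subset _ _ _ hx
  suffices hmain : ∃ Q P : Finset V, P ⊆ S ∧ (∀ y ∈ Q, DipathIn D P (ℓ - 1) x y) ∧
      1 / (12 * ℓ * a) * σ ≤ #(newNbrs D Q P S) by
    obtain ⟨Q, P, hPS, hQ, hcard⟩ := hmain
    have hpath : ∀ y ∈ newNbrs D Q P S, DipathIn D S ℓ x y := by
      intro y hy
      have h1 := dipathIn_of_mem_newNbrs hQ hy
      rw [Nat.sub_add_cancel hℓ] at h1
      exact h1.mono (insert_subset (filter_subset _ _ hy) hPS)
    refine ⟨x, hxS, newNbrs D Q P S, filter_subset _ _, fun hxY => ?_, hpath, hcard⟩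
    obtain ⟨f, h0, hk, hinj, -, -⟩ := hpath x hxY
    have := hinj (by simp : 0 ∈ Set.Iic ℓ) (by simp : ℓ ∈ Set.Iic ℓ) (h0.trans hk.symm)
    omega
  rcases Nat.lt_or_ge 1 ℓ with hℓ2 | hℓ2
  swap
  · obtain rfl : ℓ = 1 := by omega
    refine ⟨{x}, {x}, by simpa using hxS, by simpa using DipathIn.refl x, ?_⟩
    have h1 : η ≤ #(outNbrs D S x) := le_card_outNbrs_of_mem_outCore (i := 0) hx
    have h2 : (#(outNbrs D S x) : ℝ) ≤ #(newNbrs D {x} {x} S) := by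
      exact_mod_cast card_le_card (outNbrs_subset_newNbrs_singleton hirr S x)
    refine le_trans ?_ (h1.trans h2)
    rw [hη]
    have hpa : p = 1 / a := by
      field_simp
      simpa [mul_comm] using hap
    rw [hpa]
    push_cast
    rw [div_mul_eq_mul_div, one_mul, one_div_mul_eq_div, div_div, mul_one, mul_one, mul_comm a]
    gcongr
    norm_num
  · set κ : ℕ := ⌈a⌉₊ with hκdef
    set M : ℕ := ⌈8 * lam⌉₊ with hMdef
    have hκa : a ≤ κ := Nat.le_ceil a
    have hκa' : (κ : ℝ) < a + 1 := Nat.ceil_lt_add_one ha0.le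
    have hMl : 8 * lam ≤ M := Nat.le_ceil _
    have hMl' : (M : ℝ) < 8 * lam + 1 := Nat.ceil_lt_add_one (by linarith)
    have hκ2 : 2 ≤ κ := by
      have : (2 : ℝ) ≤ κ := by linarith
      exact_mod_cast this
    have hM1 : 1 ≤ M := by
      have : (1 : ℝ) ≤ M := by linarith
      exact_mod_cast this
    have hκ1 : (1 : ℝ) ≤ κ := by linarith
    -- Rounding a up to κ costs a factor of at most (1 + 1/a) ^ ℓ ≤ exp(1/128), because a ≥ 128 ℓ.
    have hκpow : (κ : ℝ) ^ ℓ * p ≤ 2 := by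
      have h1 : (κ : ℝ) ≤ a * Real.exp (1 / (128 * ℓ)) := by
        have h2 := Real.add_one_le_exp (1 / (128 * (ℓ : ℝ)))
        have h3 : 1 ≤ a * (1 / (128 * ℓ)) := by
          rw [mul_one_div, one_le_div (by positivity)]
          exact ha
        nlinarith
      calc (κ : ℝ) ^ ℓ * p ≤ (a * Real.exp (1 / (128 * ℓ))) ^ ℓ * p := by gcongr
        _ = Real.exp (1 / 128) * (a ^ ℓ * p) := by
          rw [mul_pow, ← Real.exp_nat_mul]
          have : (ℓ : ℝ) * (1 / (128 * ℓ)) = 1 / 128 := by field_simp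
          rw [this]
          ring
        _ ≤ 2 := by
          rw [hap, mul_one]
          have h4 : Real.exp (1 / 128) ≤ Real.exp (Real.log 2) := by
            apply Real.exp_le_exp.2
            linarith [Real.log_two_gt_d9]
          rwa [Real.exp_log (by norm_num)] at h4
    have hpowi : ∀ i < ℓ, p * (κ : ℝ) ^ i ≤ 2 := by
      intro i hi
      calc p * (κ : ℝ) ^ i ≤ p * (κ : ℝ) ^ ℓ := by gcongr
        _ ≤ 2 := by linarith
    have hMi : ∀ i < ℓ, 4 * p * (M * (κ : ℝ) ^ i) ≤ 8 * M := by
      intro i hi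
      have := mul_le_mul_of_nonneg_left (hpowi i hi) (by positivity : (0 : ℝ) ≤ 4 * M)
      linarith
    have hal : 128 * lam ≤ a * lam := by gcongr
    have hη₁ : (M * κ : ℝ) ≤ η := by
      calc (M * κ : ℝ) ≤ (9 * lam) * (2 * a) := by gcongr <;> linarith
        _ ≤ η := by nlinarith
    have hη₂ : ∀ i < ℓ, 4 * p * (M * (κ : ℝ) ^ i) + 9 * κ * lam < η := by
      intro i hi
      have h1 : 9 * (κ : ℝ) * lam ≤ 9 * (2 * a) * lam := by gcongr; linarith
      have h2 := hMi i hi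
      nlinarith
    obtain ⟨j, hj⟩ : ∃ j, ℓ = j + 2 := ⟨ℓ - 2, by omega⟩
    obtain ⟨Q, P, hQ, hP, hQc, hPc, hpath⟩ := exists_level hp.le (by linarith) hirr hfew hκ2 hM1
      hη₁ hη₂ hx j (by omega)
    refine ⟨Q, P, hP, ?_, ?_⟩
    · have : ℓ - 1 = j + 1 := by omega
      rwa [this]
    · by_contra hcon
      push Not at hcon
      have hℓj : ℓ - (j + 1) = 0 + 1 := by omega
      rw [hℓj] at hQ
      have h3 := mul_card_le_of_hasFewArcs (R := S) (η := η) hfew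
        (hQ.trans (outCore_subset _ _ _)) hP Subset.rfl
        (fun a ha => le_card_outNbrs_of_mem_outCore (i := 0) (hQ ha))
      set N := newNbrs D Q P S ∪ P with hN
      set q : ℝ := M * (κ : ℝ) ^ (j + 1) with hq
      have hq0 : 0 < q := by rw [hq]; positivity
      have hQq : (#Q : ℝ) = q := by rw [hQc, hq]; push_cast; rfl
      have hNq : (#N : ℝ) ≤ 1 / (12 * ℓ * a) * σ + 2 * q := by
        have h5 : (#N : ℝ) ≤ #(newNbrs D Q P S) + #P := by exact_mod_cast card_union_le _ _
        have h6 : (#P : ℝ) ≤ 2 * q := by rw [hq]; exact_mod_cast hPc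
        linarith
      set t : ℝ := 1 / (12 * ℓ * a) * σ with ht
      have ht0 : 0 ≤ t := by positivity
      rw [hQq] at h3
      have h9 : η * q ≤ 2 * p * q * (t + 2 * q) + 3 * (q + (t + 2 * q)) * lam := by
        refine h3.trans ?_
        gcongr
      have h10 : 4 * p * q ≤ 8 * M := hMi (j + 1) (by omega)
      have h11 : 2 * p * t ≤ η / 64 := by
        have : 2 * p * t = 4 / 3 * η / a := by
          rw [ht, hη]
          field_simp
          norm_num
        rw [this, div_le_div_iff₀ ha0 (by norm_num)]
        linarith [mul_le_mul_of_nonneg_left ha128 hη0.le]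
      -- The choice M ≥ 8 lam enters here: it gives q ≥ 8 lam / (a p), while 3 t lam = 2 η lam / (a
      -- p).
      have h12 : 3 * t * lam ≤ η / 4 * q := by
        have hapq : 1 ≤ a * p * (κ : ℝ) ^ (j + 1) := by
          calc (1 : ℝ) = a ^ (j + 2) * p := by rw [← hj, hap]
            _ = a * p * a ^ (j + 1) := by ring
            _ ≤ _ := by gcongr
        have h13 : 3 * t * lam = 2 * η * lam / (a * p) := by
          rw [ht, hη]
          field_simp
          norm_num
        rw [h13, div_le_iff₀ (by positivity), hq]
        have h16 : 8 * lam * 1 ≤ M * (a * p * (κ : ℝ) ^ (j + 1)) := by gcongr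
        have h17 := mul_le_mul_of_nonneg_left h16 (by positivity : 0 ≤ η / 4)
        linarith
      have h14 : η * q ≤ (η / 64 + 8 * M + 9 * lam + η / 4) * q := by
        have e1 := mul_le_mul_of_nonneg_right h10 hq0.le
        have e2 := mul_le_mul_of_nonneg_right h11 hq0.le
        linarith
      have h15 := le_of_mul_le_mul_right h14 hq0
      linarith

end Dipaths

/-! ### Vertex-by-vertex bound on the weighted number of admissible arc sets. -/

section Exposure

open Finset

variable {V : Type*} {D : Finset (V × V)}

lemma not_digraphFree_of_dipathIn {ℓ : ℕ} {P : Finset V} {v x y : V} (hvx : (v, x) ∈ D)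
    (hyv : (y, v) ∈ D) (hv : v ∉ P) (h : DipathIn D P ℓ x y) :
    ¬ DigraphFree (directedCycle (ℓ + 2)) (⟨fun u v => (u, v) ∈ D⟩ : Digraph V) := by
  obtain ⟨f, h0, hk, hinj, hmem, harc⟩ := h
  rw [DigraphFree, not_not]
  have hne : ∀ i ≤ ℓ, f i ≠ v := fun i hi e => hv (e ▸ hmem i hi)
  refine ⟨⟨fun i => if (i : ℕ) ≤ ℓ then f i else v, ?_⟩, ?_⟩
  · intro i j hij
    have hi := i.isLt
    have hj := j.isLt
    dsimp only at hij
    split_ifs at hij with h1 h2 h2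
    · exact Fin.ext (hinj h1 h2 hij)
    · exact absurd hij (hne _ h1)
    · exact absurd hij.symm (hne _ h2)
    · exact Fin.ext (by omega)
  · rintro i _ rfl
    have hi := i.isLt
    change ((if (i : ℕ) ≤ ℓ then f i else v),
      (if ((i + 1 : Fin (ℓ + 1 + 1)) : ℕ) ≤ ℓ then f (i + 1 : Fin (ℓ + 1 + 1)) else v)) ∈ D
    rw [Fin.val_add_one]
    by_cases hlast : i = Fin.last (ℓ + 1)
    · subst hlast
      simpa [h0] using hvx
    · have hi' : (i : ℕ) ≠ ℓ + 1 := fun e => hlast (Fin.ext e)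
      rw [if_neg hlast, if_pos (by omega : (i : ℕ) ≤ ℓ)]
      rcases Nat.lt_or_ge (i : ℕ) ℓ with h1 | h1
      · rw [if_pos (by omega : (i : ℕ) + 1 ≤ ℓ)]
        exact harc i h1
      · have : (i : ℕ) = ℓ := by omega
        rw [if_neg (by omega : ¬ (i : ℕ) + 1 ≤ ℓ), this, hk]
        exact hyv

variable [DecidableEq V]

lemma HasFewArcs.mono {S T : Finset V} {p lam : ℝ} (h : HasFewArcs D T p lam) (hST : S ⊆ T) :
    HasFewArcs D S p lam :=
  fun Q hQ N hN => h Q (hQ.trans hST) N (hN.trans hST)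

lemma HasManyArcs.mono {S T : Finset V} {p lam : ℝ} (h : HasManyArcs D T p lam) (hST : S ⊆ T) :
    HasManyArcs D S p lam :=
  fun L hL => h L (hL.trans hST)

/-- `D` is the arc set of an oriented graph without directed cycles of length `ℓ + 2` whose arcs
are distributed on `S` as in a typical random graph of density `p`. -/
structure IsAdmissible (ℓ : ℕ) (p lam : ℝ) (S : Finset V) (D : Finset (V × V)) : Prop where
  asymm : ∀ u v, (u, v) ∈ D → (v, u) ∉ D
  free : DigraphFree (directedCycle (ℓ + 2)) (⟨fun u v => (u, v) ∈ D⟩ : Digraph V)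
  few : HasFewArcs D S p lam
  many : HasManyArcs D S p lam

lemma IsAdmissible.irrefl {ℓ : ℕ} {p lam : ℝ} {S : Finset V} (h : IsAdmissible ℓ p lam S D)
    (v : V) : (v, v) ∉ D :=
  fun hv => h.asymm v v hv hv

lemma arcCount_inter_product {S Q N : Finset V} (hQ : Q ⊆ S) (hN : N ⊆ S) :
    arcCount (D ∩ S ×ˢ S) Q N = arcCount D Q N := by
  unfold arcCount
  congr 1
  ext ⟨u, v⟩
  simp only [mem_filter, mem_inter, mem_product]
  exact ⟨fun h => ⟨h.1.1, h.2⟩, fun h => ⟨⟨h.1, hQ h.2.1, hN h.2.2⟩, h.2⟩⟩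

lemma IsAdmissible.inter_product {ℓ : ℕ} {p lam : ℝ} {S T : Finset V} (hST : S ⊆ T)
    (h : IsAdmissible ℓ p lam T D) : IsAdmissible ℓ p lam S (D ∩ S ×ˢ S) where
  asymm u v huv hvu := h.asymm u v (mem_inter.1 huv).1 (mem_inter.1 hvu).1
  free := fun ⟨f, hf⟩ => h.free ⟨f, fun i j hij => (mem_inter.1 (hf i j hij)).1⟩
  few Q hQ N hN := by
    rw [arcCount_inter_product hQ hN]
    exact h.few Q (hQ.trans hST) N (hN.trans hST)
  many L hL hcard := by
    rw [arcCount_inter_product hL hL]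
    exact h.many L (hL.trans hST) hcard

open Classical in
/-- The admissible arc sets on `S`. -/
noncomputable def admissibleArcSets (ℓ : ℕ) (p lam : ℝ) (S : Finset V) :
    Finset (Finset (V × V)) :=
  {D ∈ (S ×ˢ S).powerset | IsAdmissible ℓ p lam S D}

lemma card_eq_of_subset_insert {S : Finset V} {v : V} (hv : v ∉ S)
    (hD : D ⊆ insert v S ×ˢ insert v S) (hvv : (v, v) ∉ D) :
    #D = #(D ∩ S ×ˢ S) + #{y ∈ S | (v, y) ∈ D} + #{y ∈ S | (y, v) ∈ D} := by
  have hA : #{y ∈ S | (v, y) ∈ D} = #{e ∈ D | e.1 = v} := by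
    refine card_bij (fun y _ => (v, y)) ?_ ?_ ?_
    · intro y hy
      simp only [mem_filter] at hy ⊢
      exact ⟨hy.2, trivial⟩
    · intro y _ z _ h
      exact (Prod.ext_iff.1 h).2
    · rintro ⟨u, w⟩ hw
      simp only [mem_filter] at hw
      obtain ⟨h1, rfl⟩ := hw
      have h2 := hD h1
      simp only [mem_product, mem_insert] at h2
      refine ⟨w, ?_, rfl⟩
      rw [mem_filter]
      refine ⟨h2.2.resolve_left ?_, h1⟩
      rintro rfl
      exact hvv h1
  have hB : #{y ∈ S | (y, v) ∈ D} = #{e ∈ {e ∈ D | ¬ e.1 = v} | e.2 = v} := by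
    refine card_bij (fun y _ => (y, v)) ?_ ?_ ?_
    · intro y hy
      simp only [mem_filter] at hy ⊢
      exact ⟨⟨hy.2, fun e => hv (e ▸ hy.1)⟩, trivial⟩
    · intro y _ z _ h
      exact (Prod.ext_iff.1 h).1
    · rintro ⟨u, w⟩ hw
      simp only [mem_filter] at hw
      obtain ⟨⟨h1, h3⟩, rfl⟩ := hw
      have h2 := hD h1
      rw [mem_product, mem_insert, mem_insert] at h2
      exact ⟨u, mem_filter.2 ⟨h2.1.resolve_left h3, h1⟩, rfl⟩
  have hC : D ∩ S ×ˢ S = {e ∈ {e ∈ D | ¬ e.1 = v} | ¬ e.2 = v} := by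
    ext ⟨u, w⟩
    simp only [mem_filter, mem_inter, mem_product]
    constructor
    · rintro ⟨h1, h2, h3⟩
      exact ⟨⟨h1, fun e => hv (e ▸ h2)⟩, fun e => hv (e ▸ h3)⟩
    · rintro ⟨⟨h1, h2⟩, h3⟩
      have h4 := hD h1
      rw [mem_product, mem_insert, mem_insert] at h4
      exact ⟨h1, h4.1.resolve_left h2, h4.2.resolve_left h3⟩
  rw [hA, hB, hC, ← card_filter_add_card_filter_not (s := D) (fun e => e.1 = v),
    ← card_filter_add_card_filter_not (s := {e ∈ D | ¬ e.1 = v}) (fun e => e.2 = v)]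
  omega

lemma eq_of_subset_insert {S : Finset V} {v : V} {D' : Finset (V × V)}
    (hD : D ⊆ insert v S ×ˢ insert v S) (hvv : (v, v) ∉ D)
    (hD' : D' ⊆ insert v S ×ˢ insert v S) (hvv' : (v, v) ∉ D')
    (h : D ∩ S ×ˢ S = D' ∩ S ×ˢ S) (hout : {y ∈ S | (v, y) ∈ D} = {y ∈ S | (v, y) ∈ D'})
    (hin : {y ∈ S | (y, v) ∈ D} = {y ∈ S | (y, v) ∈ D'}) : D = D' := by
  have key : ∀ e ∈ insert v S ×ˢ insert v S, e ∈ D ↔ e ∈ D' := by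
    rintro ⟨u, w⟩ huw
    simp only [mem_product, mem_insert] at huw
    obtain ⟨rfl | hu, rfl | hw⟩ := huw
    · exact iff_of_false hvv hvv'
    · simpa [hw] using Finset.ext_iff.1 hout w
    · simpa [hu] using Finset.ext_iff.1 hin u
    · have hu' : u ∈ S := hu
      have hw' : w ∈ S := hw
      simpa [hu', hw'] using Finset.ext_iff.1 h (u, w)
  ext e
  exact ⟨fun he => (key e (hD he)).1 he, fun he => (key e (hD' he)).2 he⟩

/-- An arc set on S + v is determined by its restriction to S and the two neighbourhoods A, B of v,
and its weight factors accordingly. The restriction is again admissible, and a path with ℓ arcs from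
A to B would close a cycle through v. -/
lemma sum_admissibleArcSets_insert_le {ℓ : ℕ} {p lam r K : ℝ} (hr : 0 ≤ r) {S : Finset V} {v : V}
    (hv : v ∉ S)
    (hK : ∀ D, IsAdmissible ℓ p lam S D → avoidingSum (DipathIn D S ℓ) r S S ≤ K) :
    ∑ D ∈ admissibleArcSets ℓ p lam (insert v S), r ^ #D ≤
      K * ∑ D ∈ admissibleArcSets ℓ p lam S, r ^ #D := by
  classical
  set Φ : Finset (V × V) → Finset (V × V) × Finset V × Finset V := fun D =>
    (D ∩ S ×ˢ S, {y ∈ S | (v, y) ∈ D}, {y ∈ S | (y, v) ∈ D}) with hΦ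
  set g : Finset (V × V) × Finset V × Finset V → ℝ := fun t =>
    if Disjoint t.2.1 t.2.2 ∧ ∀ a ∈ t.2.1, ∀ b ∈ t.2.2, ¬ DipathIn t.1 S ℓ a b then
      r ^ #t.1 * (r ^ #t.2.1 * r ^ #t.2.2) else 0 with hg
  have hg0 : ∀ t, 0 ≤ g t := by
    intro t
    simp only [hg]
    split_ifs <;> positivity
  have h1 : ∀ D ∈ admissibleArcSets ℓ p lam (insert v S), r ^ #D = g (Φ D) := by
    intro D hD
    rw [admissibleArcSets, mem_filter, mem_powerset] at hD
    obtain ⟨hD, hadm⟩ := hD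
    simp only [hg, hΦ]
    rw [if_pos, card_eq_of_subset_insert hv hD (hadm.irrefl v), pow_add, pow_add, mul_assoc]
    constructor
    · rw [disjoint_left]
      intro y hy hy'
      simp only [mem_filter] at hy hy'
      exact hadm.asymm v y hy.2 hy'.2
    · intro a ha b hb hab
      simp only [mem_filter] at ha hb
      have hab' : DipathIn D S ℓ a b := by
        obtain ⟨f, e0, ek, einj, emem, earc⟩ := hab
        exact ⟨f, e0, ek, einj, emem, fun i hi => (mem_inter.1 (earc i hi)).1⟩
      exact not_digraphFree_of_dipathIn ha.2 hb.2 hv hab' hadm.free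
  have hinj : Set.InjOn Φ (admissibleArcSets ℓ p lam (insert v S) : Set (Finset (V × V))) := by
    intro D hD D' hD' h
    rw [mem_coe, admissibleArcSets, mem_filter, mem_powerset] at hD hD'
    simp only [hΦ, Prod.mk.injEq] at h
    exact eq_of_subset_insert hD.1 (hD.2.irrefl v) hD'.1 (hD'.2.irrefl v) h.1 h.2.1 h.2.2
  have hsub : (admissibleArcSets ℓ p lam (insert v S)).image Φ ⊆
      admissibleArcSets ℓ p lam S ×ˢ (S.powerset ×ˢ S.powerset) := by
    intro t ht
    obtain ⟨D, hD, rfl⟩ := mem_image.1 ht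
    rw [admissibleArcSets, mem_filter, mem_powerset] at hD
    simp only [hΦ, mem_product, mem_powerset, admissibleArcSets, mem_filter]
    exact ⟨⟨inter_subset_right, hD.2.inter_product (subset_insert _ _)⟩, filter_subset _ _,
      filter_subset _ _⟩
  calc ∑ D ∈ admissibleArcSets ℓ p lam (insert v S), r ^ #D
      = ∑ D ∈ admissibleArcSets ℓ p lam (insert v S), g (Φ D) := sum_congr rfl h1
    _ = ∑ t ∈ (admissibleArcSets ℓ p lam (insert v S)).image Φ, g t := (sum_image hinj).symm
    _ ≤ ∑ t ∈ admissibleArcSets ℓ p lam S ×ˢ (S.powerset ×ˢ S.powerset), g t :=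
        sum_le_sum_of_subset_of_nonneg hsub fun t _ _ => hg0 t
    _ = ∑ D ∈ admissibleArcSets ℓ p lam S, r ^ #D * avoidingSum (DipathIn D S ℓ) r S S := by
        rw [sum_product]
        refine sum_congr rfl fun D _ => ?_
        rw [sum_product, avoidingSum, mul_sum]
        refine sum_congr rfl fun A _ => ?_
        rw [mul_sum]
        refine sum_congr rfl fun B _ => ?_
        simp only [hg, mul_ite, mul_zero]
    _ ≤ ∑ D ∈ admissibleArcSets ℓ p lam S, r ^ #D * K := by
        refine sum_le_sum fun D hD => ?_
        rw [admissibleArcSets, mem_filter] at hD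
        exact mul_le_mul_of_nonneg_left (hK D hD.2) (by positivity)
    _ = _ := by rw [← sum_mul, mul_comm]

lemma sum_admissibleArcSets_le {ℓ : ℕ} {p lam r K : ℝ} (hr : 0 ≤ r) (hK0 : 0 ≤ K) (T : Finset V)
    (hK : ∀ S ⊂ T, ∀ D, IsAdmissible ℓ p lam S D → avoidingMass (DipathIn D S ℓ) r S ≤ K) :
    ∑ D ∈ admissibleArcSets ℓ p lam T, r ^ #D ≤ K ^ #T * (1 + r) ^ (#T).choose 2 := by
  classical
  induction T using Finset.induction_on with
  | empty =>
    have hsub : admissibleArcSets ℓ p lam (∅ : Finset V) ⊆ {∅} := by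
      intro D hD
      rw [admissibleArcSets, mem_filter] at hD
      simpa using hD.1
    refine (sum_le_sum_of_subset_of_nonneg hsub fun _ _ _ => by positivity).trans ?_
    simp
  | insert v S hv ih =>
    have h1 := sum_admissibleArcSets_insert_le (K := K * (1 + r) ^ #S) hr hv fun D hD => by
      have h2 := hK S (ssubset_insert hv) D hD
      rwa [avoidingMass, div_le_iff₀ (by positivity)] at h2
    have h3 := ih fun S' hS' => hK S' (hS'.trans (ssubset_insert hv))
    rw [card_insert_of_notMem hv, Nat.choose_succ_succ' _ 1, Nat.choose_one_right]
    calc _ ≤ _ := h1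
      _ ≤ K * (1 + r) ^ #S * (K ^ #S * (1 + r) ^ (#S).choose 2) := by gcongr
      _ = _ := by rw [pow_add, pow_succ]; ring

/-- The constant 25/2 is 1/2 from exp(p s) plus 12 from the exponent log n / β, both in units of ℓ a
lam². -/
lemma avoidingMass_dipathIn_le {ℓ n : ℕ} {p lam r a : ℝ} (hr : 0 ≤ r) (hrp : p = r / (1 + r))
    (hℓ : 1 ≤ ℓ) (hp : 0 < p) (hp1 : p ≤ 1) (hlam : lam = Real.log n) (hlam' : 3000 ≤ lam)
    (ha : 128 * ℓ ≤ a) (hap : a ^ ℓ * p = 1) {S : Finset V} (hS : #S < n)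
    (hD : IsAdmissible ℓ p lam S D) :
    avoidingMass (DipathIn D S ℓ) r S ≤ Real.exp (25 / 2 * (ℓ * a * lam ^ 2) + lam) := by
  have hℓ1 : (1 : ℝ) ≤ ℓ := by exact_mod_cast hℓ
  have ha0 : 0 < a := by linarith
  have hs : 0 < ℓ * a * lam ^ 2 / (2 * p) := by positivity
  have hβ : 0 < 1 / (12 * ℓ * a) := by positivity
  have h1 := avoidingMass_le_exp_mul_rpow (R := DipathIn D S ℓ) hr hrp hs hβ S (by
    intro S' hS' hcard
    obtain ⟨x, hx, Y, hY, hxY, hpath, hc⟩ := exists_forall_dipathIn hℓ hp hlam' ha hap hD.irrefl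
      (hD.few.mono hS') (hD.many.mono hS') hcard
    exact ⟨x, hx, Y, hY, hxY, fun y hy => (hpath y hy).mono hS', hc⟩) S Subset.rfl
  refine h1.trans ?_
  have hn0 : (0 : ℝ) < n := by exact_mod_cast (Nat.zero_le _).trans_lt hS
  have hSn : (#S : ℝ) + 1 ≤ n := by exact_mod_cast hS
  have hbase : 1 + p * (#S : ℝ) ≤ n := by nlinarith [(Nat.cast_nonneg #S : (0 : ℝ) ≤ #S)]
  have hbase1 : 1 ≤ 1 + p * (#S : ℝ) := by
    have : 0 ≤ p * (#S : ℝ) := by positivity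
    linarith
  have hps : p * (ℓ * a * lam ^ 2 / (2 * p)) = ℓ * a * lam ^ 2 / 2 := by field_simp
  have hexp : (if (#S : ℝ) < ℓ * a * lam ^ 2 / (2 * p) then 0 else
      1 + Real.log ((#S : ℝ) / (ℓ * a * lam ^ 2 / (2 * p))) / (1 / (12 * ℓ * a))) ≤
      1 + 12 * ℓ * a * lam := by
    split_ifs with h
    · positivity
    · push Not at h
      have hs1 : 1 ≤ ℓ * a * lam ^ 2 / (2 * p) := by
        rw [le_div_iff₀ (by positivity)]
        have : 128 ≤ ℓ * a := by nlinarith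
        nlinarith
      have : Real.log ((#S : ℝ) / (ℓ * a * lam ^ 2 / (2 * p))) ≤ lam := by
        refine (Real.log_le_log (div_pos (hs.trans_le h) hs) ?_).trans_eq hlam.symm
        exact (div_le_self (by positivity) hs1).trans (by linarith)
      rw [div_div_eq_mul_div, div_one]
      nlinarith [mul_le_mul_of_nonneg_right this (by positivity : (0 : ℝ) ≤ 12 * ℓ * a)]
  calc _ ≤ Real.exp (p * (ℓ * a * lam ^ 2 / (2 * p))) * (n : ℝ) ^ (1 + 12 * ℓ * a * lam) := by
        gcongr
        exact (Real.rpow_le_rpow_of_exponent_le hbase1 hexp).trans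
          (Real.rpow_le_rpow (by linarith) hbase (by positivity))
    _ = Real.exp (ℓ * a * lam ^ 2 / 2 + lam * (1 + 12 * ℓ * a * lam)) := by
        rw [hps, Real.rpow_def_of_pos hn0, ← hlam, ← Real.exp_add]
    _ = _ := by
        congr 1
        ring

end Exposure

/-! ### Edge distribution of the binomial random graph. -/

section RandomGraph

open Finset MeasureTheory

open scoped unitInterval

/-- Markov's inequality on a finite space; subadditivity alone is used, so no measurability is
needed. -/
lemma real_le_sum_mul {α : Type*} [Fintype α] [MeasurableSpace α] (μ : Measure α) (A : Set α)
    (f : α → ℝ) (hf : ∀ x, 0 ≤ f x) (hA : ∀ x ∈ A, 1 ≤ f x) :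
    μ.real A ≤ ∑ x, μ.real {x} * f x := by
  classical
  have h1 : A = ⋃ x ∈ ({x | x ∈ A} : Finset α), {x} := by
    ext x
    simp
  calc μ.real A ≤ ∑ x ∈ ({x | x ∈ A} : Finset α), μ.real {x} := by
        conv_lhs => rw [h1]
        exact measureReal_biUnion_finset_le _ _
    _ ≤ ∑ x ∈ ({x | x ∈ A} : Finset α), μ.real {x} * f x := by
        refine sum_le_sum fun x hx => ?_
        exact le_mul_of_one_le_right measureReal_nonneg (hA x (by simpa using hx))
    _ ≤ _ := sum_le_sum_of_subset_of_nonneg (subset_univ _) fun x _ _ =>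
        mul_nonneg measureReal_nonneg (hf x)

variable {V : Type*}

lemma sum_pow_card_le_exp [Fintype V] {y : ℝ} (hy : 0 ≤ y) (hy1 : Fintype.card V * y ≤ 1) :
    ∑ Q : Finset V, y ^ #Q ≤ Real.exp 1 := by
  have h1 : ∑ Q : Finset V, y ^ #Q = (1 + y) ^ Fintype.card V := by
    have := Fintype.sum_pow_mul_eq_add_pow V y 1
    simpa [add_comm] using this
  rw [h1]
  calc (1 + y) ^ Fintype.card V ≤ Real.exp y ^ Fintype.card V := by
        gcongr
        linarith [Real.add_one_le_exp y]
    _ = Real.exp (Fintype.card V * y) := by rw [Real.exp_nat_mul]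
    _ ≤ _ := Real.exp_le_exp.2 hy1

open Classical in
/-- The number of edges of `G` in the set `P` of pairs. -/
noncomputable def edgeCount (G : SimpleGraph V) (P : Finset (Sym2 V)) : ℕ :=
  #{e ∈ P | e ∈ G.edgeSet}

variable [DecidableEq V]

/-- The pairs with one element in `Q` and the other in `N`. -/
def pairsBetween (Q N : Finset V) : Finset (Sym2 V) :=
  {e ∈ (Q ×ˢ N).image (Function.uncurry Sym2.mk) | ¬ e.IsDiag}

/-- The pairs of distinct elements of `L`. -/
def pairsWithin (L : Finset V) : Finset (Sym2 V) := L.offDiag.image (Function.uncurry Sym2.mk)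

lemma card_pairsBetween_le (Q N : Finset V) : #(pairsBetween Q N) ≤ #Q * #N := by
  refine (card_filter_le _ _).trans (card_image_le.trans ?_)
  rw [card_product]

lemma edgeCount_eq_zero_of_empty (G : SimpleGraph V) (N : Finset V) :
    edgeCount G (pairsBetween ∅ N) = 0 := by
  simp [edgeCount, pairsBetween]

variable [Fintype V]

lemma binomialRandom_real_singleton (p : I) {r : ℝ} (hp : (p : ℝ) < 1) (hr : r = p / (1 - p))
    (G : SimpleGraph V) :
    (SimpleGraph.binomialRandom V p).real {G} =
      r ^ G.edgeSet.ncard / (1 + r) ^ (Fintype.card V).choose 2 := by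
  classical
  have hle : G.edgeSet.ncard ≤ (Fintype.card V).choose 2 := by
    rw [← SimpleGraph.card_edgeFinset_top_eq_card_choose_two, Set.ncard_eq_toFinset_card']
    exact card_le_card (SimpleGraph.edgeFinset_mono le_top)
  have h1 : (0 : ℝ) < 1 - p := by linarith
  have h2 : 1 + r = (1 - p : ℝ)⁻¹ := by
    rw [hr]
    field_simp
    ring
  rw [Measure.real, SimpleGraph.binomialRandom_singleton, ENNReal.toReal_mul, ENNReal.toReal_pow,
    ENNReal.toReal_pow, Nat.card_eq_fintype_card]
  have e1 : ((unitInterval.toNNReal p : ENNReal)).toReal = (p : ℝ) := rfl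
  have e2 : ((unitInterval.toNNReal (unitInterval.symm p) : ENNReal)).toReal = 1 - (p : ℝ) := rfl
  rw [e1, e2, h2, hr, div_pow, inv_pow, div_inv_eq_mul, pow_sub₀ _ h1.ne' hle]
  field_simp

/-- The moment bound behind both Chernoff estimates. In odds form the sum is bounded by a product
over pairs, with 1 + r c = (1 + r)(1 + p (c - 1)) at each pair of P. -/
lemma sum_real_mul_pow_edgeCount_le (p : I) (hp : (p : ℝ) < 1) {c : ℝ} (hc : 0 ≤ c)
    {P : Finset (Sym2 V)} (hP : ∀ e ∈ P, ¬ e.IsDiag) :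
    ∑ G : SimpleGraph V, (SimpleGraph.binomialRandom V p).real {G} * c ^ edgeCount G P ≤
      Real.exp (p * (c - 1) * #P) := by
  classical
  set r : ℝ := p / (1 - p) with hr
  have hp0 : (0 : ℝ) ≤ p := p.2.1
  have h1p : (0 : ℝ) < 1 - p := by linarith
  have hr0 : 0 ≤ r := by positivity
  set E : Finset (Sym2 V) := (⊤ : SimpleGraph V).edgeFinset with hE
  have hPE : P ⊆ E := by
    intro e he
    rw [hE, SimpleGraph.mem_edgeFinset, SimpleGraph.edgeSet_top]
    exact hP e he
  set w : Sym2 V → ℝ := fun e => r * (if e ∈ P then c else 1) with hw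
  have hw0 : ∀ e, 0 ≤ w e := fun e => mul_nonneg hr0 (by split_ifs <;> positivity)
  have h1 : ∀ G : SimpleGraph V, r ^ G.edgeSet.ncard * c ^ edgeCount G P =
      ∏ e ∈ G.edgeFinset, w e := by
    intro G
    rw [hw, prod_mul_distrib, prod_const, prod_ite, prod_const, prod_const, one_pow, mul_one,
      Set.ncard_eq_toFinset_card']
    congr 2
    unfold edgeCount
    congr 1
    ext e
    simp [and_comm]
  have h2 : ∑ G : SimpleGraph V, r ^ G.edgeSet.ncard * c ^ edgeCount G P ≤
      ∏ e ∈ E, (1 + w e) := by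
    rw [prod_one_add, sum_congr rfl fun G _ => h1 G]
    have hinj : Set.InjOn (fun G : SimpleGraph V => G.edgeFinset)
        ((univ : Finset (SimpleGraph V)) : Set (SimpleGraph V)) := by
      intro G _ H _ h
      exact SimpleGraph.edgeFinset_inj.1 h
    rw [← sum_image (f := fun t => ∏ e ∈ t, w e) hinj]
    refine sum_le_sum_of_subset_of_nonneg ?_ fun t _ _ => prod_nonneg fun e _ => hw0 e
    intro t ht
    obtain ⟨G, -, rfl⟩ := mem_image.1 ht
    exact mem_powerset.2 (SimpleGraph.edgeFinset_mono le_top)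
  have h3 : ∏ e ∈ E, (1 + w e) ≤ Real.exp (p * (c - 1) * #P) * (1 + r) ^ #E := by
    calc ∏ e ∈ E, (1 + w e) ≤
          ∏ e ∈ E, (if e ∈ P then Real.exp (p * (c - 1)) else 1) * (1 + r) := by
          refine prod_le_prod (fun e _ => add_nonneg zero_le_one (hw0 e)) fun e _ => ?_
          simp only [hw]
          split_ifs
          · have : 1 + r * c = (p * (c - 1) + 1) * (1 + r) := by
              rw [hr]
              field_simp
              ring
            rw [this]
            gcongr
            exact Real.add_one_le_exp _
          · simp
      _ = _ := by
          rw [prod_mul_distrib, prod_const, prod_ite, prod_const, prod_const, one_pow, mul_one,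
            ← Real.exp_nat_mul]
          congr 2
          have : {x ∈ E | x ∈ P} = P := by
            ext e
            simp only [mem_filter]
            exact ⟨fun h => h.2, fun h => ⟨hPE h, h⟩⟩
          rw [this]
          ring
  have hcard : #E = (Fintype.card V).choose 2 :=
    SimpleGraph.card_edgeFinset_top_eq_card_choose_two
  rw [hcard] at h3
  calc _ = (∑ G : SimpleGraph V, r ^ G.edgeSet.ncard * c ^ edgeCount G P) /
        (1 + r) ^ (Fintype.card V).choose 2 := by
        rw [sum_div]
        refine sum_congr rfl fun G _ => ?_
        rw [binomialRandom_real_singleton p hp hr]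
        ring
    _ ≤ _ := by
        rw [div_le_iff₀ (by positivity)]
        exact h2.trans h3

lemma real_edgeCount_pairsBetween_gt_le (p : I) (hp : (p : ℝ) < 1) {t : ℝ} (Q N : Finset V) :
    (SimpleGraph.binomialRandom V p).real
      {G | 2 * (p : ℝ) * #Q * #N + t < (edgeCount G (pairsBetween Q N) : ℝ)} ≤ Real.exp (-t) := by
  have hp0 : (0 : ℝ) ≤ p := p.2.1
  set b : ℝ := 2 * p * #Q * #N + t with hb
  have h1 := real_le_sum_mul (SimpleGraph.binomialRandom V p)
    {G | b < edgeCount G (pairsBetween Q N)}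
    (fun G => Real.exp (-b) * Real.exp 1 ^ edgeCount G (pairsBetween Q N))
    (fun G => by positivity) (by
      intro G hG
      rw [← Real.exp_nat_mul, ← Real.exp_add]
      apply Real.one_le_exp
      have : b < edgeCount G (pairsBetween Q N) := hG
      linarith)
  have h2 := sum_real_mul_pow_edgeCount_le (P := pairsBetween Q N) p hp (Real.exp_pos 1).le
    (fun e he => (mem_filter.1 he).2)
  refine h1.trans ?_
  calc _ = Real.exp (-b) * ∑ G : SimpleGraph V, (SimpleGraph.binomialRandom V p).real {G} *
          Real.exp 1 ^ edgeCount G (pairsBetween Q N) := by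
        rw [mul_sum]
        exact sum_congr rfl fun G _ => by ring
    _ ≤ Real.exp (-b) * Real.exp (p * (Real.exp 1 - 1) * #(pairsBetween Q N)) := by gcongr
    _ ≤ Real.exp (-b) * Real.exp (p * 2 * (#Q * #N)) := by
        have h3 : (#(pairsBetween Q N) : ℝ) ≤ #Q * #N := by exact_mod_cast card_pairsBetween_le Q N
        have h4 : Real.exp 1 - 1 ≤ 2 := by linarith [Real.exp_one_lt_d9]
        have h5 : 0 ≤ Real.exp 1 - 1 := by linarith [Real.add_one_le_exp (1 : ℝ)]
        gcongr
    _ = Real.exp (-t) := by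
        rw [← Real.exp_add]
        congr 1
        rw [hb]
        ring

/-- Chernoff with c = 1/2. As #L - 1 ≥ (49/50) #L, the exponent per unit of p #L² is at most 0.7/4 -
0.245 = -0.07. -/
lemma real_edgeCount_pairsWithin_lt_le (p : I) (hp : (p : ℝ) < 1) (L : Finset V)
    (hL : 50 ≤ #L) :
    (SimpleGraph.binomialRandom V p).real
      {G | (edgeCount G (pairsWithin L) : ℝ) < (p : ℝ) * (#L : ℝ) ^ 2 / 4} ≤
        Real.exp (-(7 / 100 * (p * (#L : ℝ) ^ 2))) := by
  have hp0 : (0 : ℝ) ≤ p := p.2.1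
  set b : ℝ := p * (#L : ℝ) ^ 2 / 4 with hb
  have hb0 : 0 ≤ b := by positivity
  have h1 := real_le_sum_mul (SimpleGraph.binomialRandom V p)
    {G | edgeCount G (pairsWithin L) < b}
    (fun G => Real.exp (Real.log 2 * b) * (1 / 2) ^ edgeCount G (pairsWithin L))
    (fun G => by positivity) (by
      intro G hG
      have h2 : (1 / 2 : ℝ) = Real.exp (-Real.log 2) := by
        rw [Real.exp_neg, Real.exp_log (by norm_num)]
        norm_num
      rw [h2, ← Real.exp_nat_mul, ← Real.exp_add]
      apply Real.one_le_exp
      have h3 : (edgeCount G (pairsWithin L) : ℝ) < b := hG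
      nlinarith [Real.log_pos (by norm_num : (1 : ℝ) < 2)])
  have h2 := sum_real_mul_pow_edgeCount_le (P := pairsWithin L) p hp (by norm_num : (0:ℝ) ≤ 1 / 2)
    (by
      intro e he
      obtain ⟨⟨u, v⟩, huv, rfl⟩ := mem_image.1 he
      rw [mem_offDiag] at huv
      simpa [Function.uncurry] using huv.2.2)
  have hcard : (#(pairsWithin L) : ℝ) = #L * (#L - 1) / 2 := by
    rw [pairsWithin, Sym2.card_image_offDiag, Nat.cast_choose_two]
  have hL' : (50 : ℝ) ≤ #L := by exact_mod_cast hL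
  refine h1.trans ?_
  calc _ = Real.exp (Real.log 2 * b) * ∑ G : SimpleGraph V,
        (SimpleGraph.binomialRandom V p).real {G} * (1 / 2) ^ edgeCount G (pairsWithin L) := by
        rw [mul_sum]
        exact sum_congr rfl fun G _ => by ring
    _ ≤ Real.exp (Real.log 2 * b) * Real.exp (p * (1 / 2 - 1) * #(pairsWithin L)) := by gcongr
    _ ≤ _ := by
        rw [← Real.exp_add, hcard]
        apply Real.exp_le_exp.2
        have h3 : Real.log 2 * b ≤ 7 / 10 * b := by
          gcongr
          linarith [Real.log_two_lt_d9]
        have h4 : p * (50 * (#L : ℝ)) ≤ p * ((#L : ℝ) * #L) := by gcongr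
        rw [hb] at h3 ⊢
        nlinarith

/-- The edge distribution of `G` is that of a typical random graph of density `p`. -/
structure IsTypical (p lam : ℝ) (G : SimpleGraph V) : Prop where
  few : ∀ Q N : Finset V,
    (edgeCount G (pairsBetween Q N) : ℝ) ≤ 2 * p * #Q * #N + 3 * (#Q + #N) * lam
  many : ∀ L : Finset V, lam ^ 2 / (4 * p) ≤ #L →
    p * (#L : ℝ) ^ 2 / 4 ≤ edgeCount G (pairsWithin L)

lemma real_not_isTypical_le (p : I) (hp0 : 0 < (p : ℝ)) (hp : (p : ℝ) < 1) {lam : ℝ}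
    (hlam : 3000 ≤ lam) (hV : (Fintype.card V : ℝ) = Real.exp lam) :
    (SimpleGraph.binomialRandom V p).real {G | ¬ IsTypical p lam G} ≤ 11 * Real.exp (-lam) := by
  set μ := SimpleGraph.binomialRandom V p with hμ
  set y : ℝ := Real.exp (-(2 * lam)) with hy
  have hy0 : 0 ≤ y := (Real.exp_pos _).le
  have hy1 : Fintype.card V * y ≤ 1 := by
    rw [hV, hy, ← Real.exp_add, Real.exp_le_one_iff]
    linarith
  have hpow : ∀ k : ℕ, y ^ k = Real.exp (-(2 * k * lam)) := by
    intro k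
    rw [hy, ← Real.exp_nat_mul]
    congr 1
    ring
  set A : Finset V × Finset V → Set (SimpleGraph V) := fun x =>
    {G | 2 * (p : ℝ) * #x.1 * #x.2 + 3 * (#x.1 + #x.2) * lam <
      (edgeCount G (pairsBetween x.1 x.2) : ℝ)}
    with hA
  set B : Finset V → Set (SimpleGraph V) := fun L =>
    {G | lam ^ 2 / (4 * (p : ℝ)) ≤ #L ∧
      (edgeCount G (pairsWithin L) : ℝ) < (p : ℝ) * (#L : ℝ) ^ 2 / 4} with hB
  have hsub : {G : SimpleGraph V | ¬ IsTypical p lam G} ⊆ (⋃ x, A x) ∪ ⋃ L, B L := by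
    intro G hG
    by_contra hcon
    rw [Set.mem_union, not_or, Set.mem_iUnion, Set.mem_iUnion, not_exists, not_exists] at hcon
    refine hG ⟨fun Q N => ?_, fun L hL => ?_⟩
    · exact not_lt.1 (hcon.1 (Q, N))
    · exact not_lt.1 fun h => hcon.2 L ⟨hL, h⟩
  have hAle : ∀ x, μ.real (A x) ≤ Real.exp (-lam) * (y ^ #x.1 * y ^ #x.2) := by
    rintro ⟨Q, N⟩
    -- For nonempty Q, the surplus of 3 (#Q + #N) lam over 2 (#Q + #N) lam is at least lam and pays
    -- for exp(-lam). For empty Q the event is void.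
    rcases Q.eq_empty_or_nonempty with rfl | hQ
    · have : A (∅, N) = ∅ := by
        ext G
        simp only [hA, Set.mem_ofPred_eq, edgeCount_eq_zero_of_empty, Set.mem_empty_iff_false,
          iff_false, not_lt]
        simp
        positivity
      rw [this, measureReal_empty]
      positivity
    · refine (real_edgeCount_pairsBetween_gt_le p hp Q N).trans ?_
      rw [hpow, hpow, ← Real.exp_add, ← Real.exp_add]
      apply Real.exp_le_exp.2
      have h1 : (1 : ℝ) ≤ #Q := by exact_mod_cast hQ.card_pos
      have h2 : (0 : ℝ) ≤ #N := by positivity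
      nlinarith [mul_nonneg h2 (by linarith : 0 ≤ lam)]
  have hBle : ∀ L, μ.real (B L) ≤ Real.exp (-lam) * y ^ #L := by
    intro L
    by_cases hL : lam ^ 2 / (4 * p) ≤ #L
    · have hpL : lam ^ 2 / 4 ≤ p * #L := by
        rw [div_le_iff₀ (by positivity)] at hL
        linarith
      have hL1 : (50 : ℝ) ≤ #L := by
        have h0 : (0 : ℝ) ≤ #L := by positivity
        nlinarith
      refine (measureReal_mono (fun G hG => hG.2)).trans
        ((real_edgeCount_pairsWithin_lt_le p hp L (by exact_mod_cast hL1)).trans ?_)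
      rw [hpow, ← Real.exp_add]
      apply Real.exp_le_exp.2
      have h2 : lam ^ 2 / 4 * #L ≤ p * #L * #L := by gcongr
      have h3 : 3000 * lam * #L ≤ lam ^ 2 * #L := by
        gcongr
        nlinarith
      nlinarith
    · have : B L = ∅ := by
        ext G
        simp [hB, hL]
      rw [this, measureReal_empty]
      positivity
  -- The union bounds over pairs and over single sets contribute e² + e ≤ 11.
  have hexp1 : Real.exp 1 ≤ 272 / 100 := by linarith [Real.exp_one_lt_d9]
  have hsum := sum_pow_card_le_exp (V := V) hy0 hy1
  have hsum0 : 0 ≤ ∑ Q : Finset V, y ^ #Q := by positivity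
  calc μ.real {G | ¬ IsTypical p lam G} ≤ μ.real ((⋃ x, A x) ∪ ⋃ L, B L) :=
        measureReal_mono hsub
    _ ≤ μ.real (⋃ x, A x) + μ.real (⋃ L, B L) := measureReal_union_le _ _
    _ ≤ ∑ x, μ.real (A x) + ∑ L, μ.real (B L) :=
        add_le_add (measureReal_iUnion_fintype_le _) (measureReal_iUnion_fintype_le _)
    _ ≤ ∑ x : Finset V × Finset V, Real.exp (-lam) * (y ^ #x.1 * y ^ #x.2) +
        ∑ L : Finset V, Real.exp (-lam) * y ^ #L :=
        add_le_add (sum_le_sum fun x _ => hAle x) (sum_le_sum fun L _ => hBle L)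
    _ = Real.exp (-lam) * ((∑ Q : Finset V, y ^ #Q) * (∑ Q : Finset V, y ^ #Q) +
        ∑ Q : Finset V, y ^ #Q) := by
        rw [← mul_sum, ← mul_sum, Fintype.sum_prod_type, sum_mul_sum, mul_add]
    _ ≤ Real.exp (-lam) * 11 := by
        gcongr
        nlinarith
    _ = _ := by ring

end RandomGraph

/-! ### From orientations to arc sets, and the first moment. -/

section Orientations

open Finset MeasureTheory

open scoped unitInterval

variable {V : Type*} {G : SimpleGraph V} {D : Digraph V}

lemma IsOrientation.asymm (h : IsOrientation G D) {u v : V} (huv : D.Adj u v) : ¬ D.Adj v u := by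
  rcases h.2 u v (h.1 u v huv) with h' | h'
  · exact h'.2
  · exact absurd huv h'.2

lemma IsOrientation.adj_iff (h : IsOrientation G D) (u v : V) :
    G.Adj u v ↔ D.Adj u v ∨ D.Adj v u :=
  ⟨fun huv => (h.2 u v huv).or, fun huv => huv.elim (h.1 u v) fun hvu => (h.1 v u hvu).symm⟩

variable [Fintype V]

open Classical in
/-- The set of arcs of a digraph. -/
noncomputable def Digraph.arcSet (D : Digraph V) : Finset (V × V) := {e | D.Adj e.1 e.2}

lemma Digraph.mem_arcSet {D : Digraph V} {u v : V} : (u, v) ∈ D.arcSet ↔ D.Adj u v := by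
  simp [Digraph.arcSet]

lemma Digraph.arcSet_injective : Function.Injective (Digraph.arcSet : Digraph V → _) := by
  intro D D' h
  ext u v
  rw [← mem_arcSet, ← mem_arcSet, h]

lemma IsOrientation.injOn_arcSet (h : IsOrientation G D) :
    Set.InjOn (Function.uncurry Sym2.mk) (D.arcSet : Set (V × V)) := by
  rintro ⟨u, v⟩ huv ⟨u', v'⟩ huv' heq
  rw [mem_coe, Digraph.mem_arcSet] at huv huv'
  rcases Sym2.eq_iff.1 heq with ⟨rfl, rfl⟩ | ⟨rfl, rfl⟩
  · rfl
  · exact absurd huv' (h.asymm huv)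

lemma IsOrientation.fromRel_arcSet (h : IsOrientation G D) :
    SimpleGraph.fromRel (fun u v => (u, v) ∈ D.arcSet) = G := by
  ext u v
  rw [SimpleGraph.fromRel_adj, Digraph.mem_arcSet, Digraph.mem_arcSet, ← h.adj_iff]
  exact ⟨fun huv => huv.2, fun huv => ⟨huv.ne, huv⟩⟩

variable [DecidableEq V]

lemma IsOrientation.card_arcSet (h : IsOrientation G D) : #D.arcSet = G.edgeSet.ncard := by
  rw [← card_image_of_injOn h.injOn_arcSet, ← Set.ncard_coe_finset]
  congr 1
  ext e
  induction e with
  | _ u v =>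
    rw [SimpleGraph.mem_edgeSet, h.adj_iff, mem_coe, mem_image]
    constructor
    · rintro ⟨⟨u', v'⟩, huv, heq⟩
      rw [Digraph.mem_arcSet] at huv
      rcases Sym2.eq_iff.1 heq with ⟨rfl, rfl⟩ | ⟨rfl, rfl⟩
      · exact Or.inl huv
      · exact Or.inr huv
    · rintro (huv | huv)
      · exact ⟨(u, v), Digraph.mem_arcSet.2 huv, rfl⟩
      · exact ⟨(v, u), Digraph.mem_arcSet.2 huv, Sym2.eq_swap⟩

lemma IsOrientation.arcCount_le (h : IsOrientation G D) (Q N : Finset V) :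
    arcCount D.arcSet Q N ≤ edgeCount G (pairsBetween Q N) := by
  classical
  refine card_le_card_of_injOn (Function.uncurry Sym2.mk) ?_
    (h.injOn_arcSet.mono fun e he => (mem_filter.1 he).1)
  rintro ⟨u, v⟩ huv
  rw [mem_coe, mem_filter, Digraph.mem_arcSet] at huv
  have hadj : G.Adj u v := h.1 u v huv.1
  rw [mem_coe, mem_filter, pairsBetween, mem_filter]
  refine ⟨⟨mem_image_of_mem _ (mem_product.2 huv.2), ?_⟩, hadj⟩
  simpa [Function.uncurry] using hadj.ne

lemma IsOrientation.le_arcCount (h : IsOrientation G D) (L : Finset V) :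
    edgeCount G (pairsWithin L) ≤ arcCount D.arcSet L L := by
  classical
  refine (card_le_card ?_).trans (card_image_le (f := Function.uncurry Sym2.mk))
  intro e he
  rw [mem_filter, pairsWithin, mem_image] at he
  obtain ⟨⟨⟨u, v⟩, huv, rfl⟩, hadj⟩ := he
  rw [mem_offDiag] at huv
  have hadj' : G.Adj u v := hadj
  rw [mem_image]
  rcases (h.adj_iff u v).1 hadj' with h1 | h1
  · exact ⟨(u, v), mem_filter.2 ⟨Digraph.mem_arcSet.2 h1, huv.1, huv.2.1⟩, rfl⟩
  · exact ⟨(v, u), mem_filter.2 ⟨Digraph.mem_arcSet.2 h1, huv.2.1, huv.1⟩, Sym2.eq_swap⟩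

lemma IsOrientation.isAdmissible {ℓ : ℕ} {p lam : ℝ} (h : IsOrientation G D)
    (hfree : DigraphFree (directedCycle (ℓ + 2)) D) (hG : IsTypical p lam G) :
    IsAdmissible ℓ p lam univ D.arcSet where
  asymm u v huv hvu := h.asymm (Digraph.mem_arcSet.1 huv) (Digraph.mem_arcSet.1 hvu)
  free := fun ⟨f, hf⟩ => hfree ⟨f, fun i j hij => Digraph.mem_arcSet.1 (hf i j hij)⟩
  few Q _ N _ := (by exact_mod_cast h.arcCount_le Q N : (_ : ℝ) ≤ _).trans (hG.few Q N)
  many L _ hL := (hG.many L hL).trans (by exact_mod_cast h.le_arcCount L)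

-- Orientations of G embed into the fibre over G of the map from arc sets to underlying graphs, and
-- all carry the same weight. Summing over G then recovers the full sum over admissible arc sets.
open Classical in
lemma numFreeOrientations_mul_pow_le {ℓ : ℕ} {p lam r : ℝ} (hr : 0 ≤ r)
    (hG : IsTypical p lam G) :
    (numFreeOrientations G (directedCycle (ℓ + 2)) : ℝ) * r ^ G.edgeSet.ncard ≤
      ∑ A ∈ admissibleArcSets ℓ p lam univ with
        SimpleGraph.fromRel (fun u v => (u, v) ∈ A) = G, r ^ #A := by
  set X : Finset (Digraph V) :=
    {D | IsOrientation G D ∧ DigraphFree (directedCycle (ℓ + 2)) D} with hX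
  have h1 : numFreeOrientations G (directedCycle (ℓ + 2)) = #X := by
    rw [numFreeOrientations, ← Set.ncard_coe_finset, hX]
    congr 1
    ext D
    simp
  have h2 : ∀ D ∈ X, IsOrientation G D ∧ DigraphFree (directedCycle (ℓ + 2)) D :=
    fun D hD => (mem_filter.1 hD).2
  calc (numFreeOrientations G (directedCycle (ℓ + 2)) : ℝ) * r ^ G.edgeSet.ncard
      = ∑ D ∈ X, r ^ #D.arcSet := by
        rw [h1, sum_congr rfl fun D hD => by rw [(h2 D hD).1.card_arcSet], sum_const,
          nsmul_eq_mul]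
    _ = ∑ A ∈ X.image Digraph.arcSet, r ^ #A :=
        (sum_image (f := fun A => r ^ #A) Digraph.arcSet_injective.injOn).symm
    _ ≤ _ := by
        refine sum_le_sum_of_subset_of_nonneg ?_ fun _ _ _ => by positivity
        intro A hA
        obtain ⟨D, hD, rfl⟩ := mem_image.1 hA
        obtain ⟨h3, h4⟩ := h2 D hD
        rw [mem_filter, admissibleArcSets, mem_filter, univ_product_univ, powerset_univ]
        exact ⟨⟨mem_univ _, h3.isAdmissible h4 hG⟩, h3.fromRel_arcSet⟩

lemma real_isTypical_and_lt_numFreeOrientations_le {ℓ : ℕ} (p : I) (hp0 : 0 < (p : ℝ))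
    (hp : (p : ℝ) < 1) {lam a : ℝ} (hℓ : 1 ≤ ℓ) (hlam : lam = Real.log (Fintype.card V))
    (hlam' : 3000 ≤ lam) (ha : 128 * ℓ ≤ a) (hap : a ^ ℓ * p = 1) {b : ℝ} (hb : 0 < b) :
    (SimpleGraph.binomialRandom V p).real
      {G | IsTypical p lam G ∧ b < numFreeOrientations G (directedCycle (ℓ + 2))} ≤
        Real.exp (25 / 2 * (ℓ * a * lam ^ 2) + lam) ^ Fintype.card V / b := by
  classical
  set r : ℝ := p / (1 - p) with hr
  have h1p : (0 : ℝ) < 1 - p := by linarith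
  have hr0 : 0 ≤ r := by positivity
  have hrp : (p : ℝ) = r / (1 + r) := by
    rw [hr]
    field_simp
    ring
  set K : ℝ := Real.exp (25 / 2 * (ℓ * a * lam ^ 2) + lam) with hK
  have hZ := sum_admissibleArcSets_le (ℓ := ℓ) (p := p) (lam := lam) (K := K) hr0
    (Real.exp_pos _).le (univ : Finset V) fun S hS D hD =>
      avoidingMass_dipathIn_le hr0 hrp hℓ hp0 hp.le hlam hlam' ha hap
        (by simpa using card_lt_card hS) hD
  rw [card_univ] at hZ
  have h1 := real_le_sum_mul (SimpleGraph.binomialRandom V p)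
    {G | IsTypical p lam G ∧ b < numFreeOrientations G (directedCycle (ℓ + 2))}
    (fun G => if IsTypical p lam G then
      (numFreeOrientations G (directedCycle (ℓ + 2)) : ℝ) / b else 0)
    (fun G => by split_ifs <;> positivity) (by
      rintro G ⟨hG, hlt⟩
      rw [if_pos hG, one_le_div hb]
      exact hlt.le)
  refine h1.trans ?_
  calc _ ≤ ∑ G : SimpleGraph V, (∑ A ∈ admissibleArcSets ℓ p lam univ with
        SimpleGraph.fromRel (fun u v => (u, v) ∈ A) = G, r ^ #A) /
          ((1 + r) ^ (Fintype.card V).choose 2 * b) := by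
        refine sum_le_sum fun G _ => ?_
        split_ifs with hG
        · rw [binomialRandom_real_singleton p hp hr, div_mul_div_comm]
          gcongr
          rw [mul_comm]
          exact numFreeOrientations_mul_pow_le hr0 hG
        · rw [mul_zero]
          exact div_nonneg (sum_nonneg fun _ _ => pow_nonneg hr0 _) (by positivity)
    _ = (∑ A ∈ admissibleArcSets ℓ p lam univ, r ^ #A) /
          ((1 + r) ^ (Fintype.card V).choose 2 * b) := by
        rw [← sum_div]
        congr 1
        exact sum_fiberwise (admissibleArcSets ℓ (p : ℝ) lam univ)
          (fun A => SimpleGraph.fromRel fun u v => (u, v) ∈ A) fun A => r ^ #A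
    _ ≤ (K ^ Fintype.card V * (1 + r) ^ (Fintype.card V).choose 2) /
          ((1 + r) ^ (Fintype.card V).choose 2 * b) := by
        refine div_le_div_of_nonneg_right ?_ (by positivity)
        exact hZ
    _ = _ := by field_simp

end Orientations

/-! ### Conclusion. -/

theorem theorem3p1 :
    ∀ ε : ℝ, 0 < ε → ∃ N : ℕ, ∀ n : ℕ, N ≤ n → ∀ ℓ : ℕ, 1 ≤ ℓ →
      ∀ p : unitInterval, 0 < (p : ℝ) → (p : ℝ) ≤ (2 ^ 7 * (ℓ : ℝ)) ^ (-(ℓ : ℤ)) →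
        1 - ε ≤ (SimpleGraph.binomialRandom (Fin n) p).real
          {G : SimpleGraph (Fin n) |
            (numFreeOrientations G (directedCycle (ℓ + 2)) : ℝ) ≤
              Real.exp (13 * ℓ * n * (Real.log n) ^ 2 / (p : ℝ) ^ ((1 : ℝ) / ℓ))} := by
  intro ε hε
  -- The first threshold gives log n ≥ 3000. The failure probability is at most (11 + 1) / n
  -- whatever ℓ and p are, which gives the second.
  refine ⟨max ⌈Real.exp 3000⌉₊ ⌈12 / ε⌉₊, fun n hn ℓ hℓ p hp0 hple => ?_⟩
  have hn1 : Real.exp 3000 ≤ n := (Nat.le_ceil _).trans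
    (by exact_mod_cast (le_max_left _ _).trans hn)
  have hn2 : 12 / ε ≤ n := (Nat.le_ceil _).trans (by exact_mod_cast (le_max_right _ _).trans hn)
  have hn0 : (0 : ℝ) < n := (Real.exp_pos _).trans_le hn1
  have hnone : (1 : ℝ) ≤ n := by exact_mod_cast (by exact_mod_cast hn0 : 0 < n)
  have hℓ1 : (1 : ℝ) ≤ ℓ := by exact_mod_cast hℓ
  set lam : ℝ := Real.log n with hlam
  have hlam' : 3000 ≤ lam := (Real.le_log_iff_exp_le hn0).2 hn1
  have hexplam : Real.exp lam = n := Real.exp_log hn0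
  set c : ℝ := (p : ℝ) ^ ((1 : ℝ) / ℓ) with hc
  have hc0 : 0 < c := Real.rpow_pos_of_pos hp0 _
  have hcpow : c ^ ℓ = p := by
    rw [hc, one_div]
    exact Real.rpow_inv_natCast_pow hp0.le (by omega)
  have hcle : c ≤ (128 * (ℓ : ℝ))⁻¹ := by
    refine le_of_pow_le_pow_left₀ (by omega : ℓ ≠ 0) (by positivity) ?_
    rw [hcpow]
    refine hple.trans_eq ?_
    rw [zpow_neg, zpow_natCast, inv_pow]
    norm_num
  have ha : 128 * (ℓ : ℝ) ≤ c⁻¹ := by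
    rw [le_inv_comm₀ (by positivity) hc0]
    exact hcle
  have hap : c⁻¹ ^ ℓ * p = 1 := by
    rw [← hcpow, ← mul_pow, inv_mul_cancel₀ hc0.ne', one_pow]
  have hp1 : (p : ℝ) < 1 := by
    rw [← hcpow]
    refine pow_lt_one₀ hc0.le (hcle.trans_lt ?_) (by omega)
    rw [inv_lt_one_iff₀]
    right
    linarith
  set a : ℝ := c⁻¹ with hadef
  set μ := SimpleGraph.binomialRandom (Fin n) p with hμ
  set b : ℝ := Real.exp (13 * ℓ * n * lam ^ 2 / c) with hb
  have hb0 : 0 < b := Real.exp_pos _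
  have h1 : μ.real {G | ¬ IsTypical p lam G} ≤ 11 * Real.exp (-lam) :=
    real_not_isTypical_le p hp0 hp1 hlam' (by rw [Fintype.card_fin, hexplam])
  have h2 : μ.real {G | IsTypical p lam G ∧ b < numFreeOrientations G (directedCycle (ℓ + 2))} ≤
      Real.exp (-lam) := by
    refine (real_isTypical_and_lt_numFreeOrientations_le p hp0 hp1 hℓ
      (by rw [Fintype.card_fin, hlam]) hlam' ha hap hb0).trans ?_
    rw [Fintype.card_fin, ← Real.exp_nat_mul, hb, ← Real.exp_sub]
    apply Real.exp_le_exp.2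
    have h3 : 13 * ℓ * n * lam ^ 2 / c = 13 * ℓ * n * lam ^ 2 * a := by
      rw [hadef, div_eq_mul_inv]
    rw [h3]
    -- The gap between 13 and 25/2 must absorb n lam from the mass bound and the lam wanted in the
    -- exponent.
    have h4 : 4 * lam ≤ ℓ * a * lam ^ 2 := by
      have h5 : 1 ≤ ℓ * a := by nlinarith
      calc 4 * lam ≤ 1 * lam ^ 2 := by nlinarith
        _ ≤ _ := by gcongr
    have h6 : (n : ℝ) * (4 * lam) ≤ n * (ℓ * a * lam ^ 2) := by gcongr
    have h7 : 1 * lam ≤ n * lam := by gcongr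
    linarith
  set S : Set (SimpleGraph (Fin n)) :=
    {G | (numFreeOrientations G (directedCycle (ℓ + 2)) : ℝ) ≤ b} with hS
  have hcover : (Set.univ : Set (SimpleGraph (Fin n))) ⊆ S ∪ ({G | ¬ IsTypical p lam G} ∪
      {G | IsTypical p lam G ∧ b < numFreeOrientations G (directedCycle (ℓ + 2))}) := by
    intro G _
    by_cases hG : IsTypical p lam G
    · rcases le_or_gt (numFreeOrientations G (directedCycle (ℓ + 2)) : ℝ) b with h | h
      · exact Or.inl h
      · exact Or.inr (Or.inr ⟨hG, h⟩)
    · exact Or.inr (Or.inl hG)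
  have h8 : (1 : ℝ) ≤ μ.real S + (11 * Real.exp (-lam) + Real.exp (-lam)) := by
    calc (1 : ℝ) = μ.real Set.univ := by simp [hμ]
      _ ≤ _ := MeasureTheory.measureReal_mono hcover
      _ ≤ μ.real S + _ := MeasureTheory.measureReal_union_le _ _
      _ ≤ _ := by
        gcongr
        exact (MeasureTheory.measureReal_union_le _ _).trans (add_le_add h1 h2)
  have h9 : 12 * Real.exp (-lam) ≤ ε := by
    rw [Real.exp_neg, hexplam, ← div_eq_mul_inv, div_le_iff₀ hn0]
    rw [div_le_iff₀ hε] at hn2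
    linarith
  linarith
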